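/- Let $\mathfrak g$ be a 6-dimensional real nilpotent Lie algebra. A complex structure on $\mathfrak g$ is an endomorphism $J$ with $J^2=-\mathrm{Id}$ and $[JX,JY]=J[JX,Y]+J[X,JY]+[X,Y]$ for all $X,Y\in\mathfrak g$. Put $\mathfrak g_0^J=0$ and $\mathfrak g_l^J=\{X\in\mathfrak g : [X,\mathfrak g]\subseteq\mathfrak g_{l-1}^J \text{ and } [JX,\mathfrak g]\subseteq \mathfrak g_{l-1}^J\}$ for $l\ge 1$; $J$ is non-nilpotent if $\mathfrak g_l^J\neq\mathfrak g$ for all $l$. Let $d$ be the Chevalley–Eilenberg differential, extended to $\bigwedge^*\mathfrak g_{\mathbb C}^*$, so that $d\alpha(X,Y)=-\alpha([X,Y])$ for 1-forms. Let $J$ act on $\mathfrak g_{\mathbb C}^*$ by $(J\alpha)(X)=-\alpha(JX)$; a $(1,0)$-basis is a basis $\{\omega^1,\omega^2,\omega^3\}$ of the $i$-eigenspace $\mathfrak g^{1,0}$ of this action. Write $\omega^{jk}=\omega^j\wedge\omega^k$ and $\omega^{j\bar k}=\omega^j\wedge\overline{\omega^k}$, where $(\alpha\wedge\beta)(X,Y)=\alpha(X)\beta(Y)-\alpha(Y)\beta(X)$.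 If $g$ is an inner product on $\mathfrak g$ with $g(JX,JY)=g(X,Y)$, the fundamental form of the Hermitian structure $(J,g)$ is $F(X,Y)=g(X,JY)$, and the structure is balanced if $d(F\wedge F)=0$. Finally, let $\mathfrak n=(0,0,0,12,23,14-35)$ be the real Lie algebra whose dual has a basis $e^1,\dots,e^6$ with $de^1=de^2=de^3=0$, $de^4=e^1\wedge e^2$, $de^5=e^2\wedge e^3$, $de^6=e^1\wedge e^4-e^3\wedge e^5$. Suppose that $\mathfrak g$ has a balanced Hermitian structure with non-nilpotent complex structure $J$ and fundamental form $F$. Then: (a) $\mathfrak g\cong\mathfrak n$. (b) There is a $(1,0)$-basis $\{\omega^1,\omega^2,\omega^3\}$ satisfying, for some choice of the sign, $$d\omega^1=0,\qquad d\omega^2=\omega^{13}+\omega^{1\bar3},\qquad d\omega^3=\pm i\,(\omega^{1\bar2}-\omega^{2\bar1}),$$ such that, for some non-zero $r,s,t\in\mathbb R$ and some $u,v,z\in\mathbb C$, $$2F=i(r^2\omega^{1\bar1}+s^2\omega^{2\bar2}+t^2\omega^{3\bar3})+u\,\omega^{1\bar2}-\bar u\,\omega^{2\bar1}+v\,\omega^{2\bar3}-\bar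 v\,\omega^{3\bar2}+z\,\omega^{1\bar3}-\bar z\,\omega^{3\bar1},$$ with $u+\bar u=0$ and $z=-iuv/s^2$. (c) For every $(1,0)$-basis that satisfies $$d\omega^1=0,\qquad d\omega^2=\omega^{13}+\omega^{1\bar3},\qquad d\omega^3=i\epsilon\,\omega^{1\bar1}\pm i\,(\omega^{1\bar2}-\omega^{2\bar1})$$ for some $\epsilon\in\{0,1\}$ and some sign, one has $\epsilon=0$, and $F$ has the form given in (b) with respect to this basis, with non-zero $r,s,t\in\mathbb R$ and $u,v,z\in\mathbb C$ such that $u+\bar u=0$ and $z=-iuv/s^2$. -/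

import Mathlib

open scoped ComplexConjugate

namespace NilpotentBalanced

noncomputable section

section Forms

variable {𝔤 : Type*} [LieRing 𝔤] [LieAlgebra ℝ 𝔤]
variable {A : Type*} [CommRing A] [Algebra ℝ A]

/-- The wedge product of two `A`-valued alternating forms on `𝔤` (with `A = ℝ` or `A = ℂ`),
`(α ∧ β)(v) = (1 / (p! q!)) ∑_σ sign(σ) α(v_σ(1), …, v_σ(p)) β(v_σ(p+1), …, v_σ(p+q))`,
so that `(α ∧ β)(X, Y) = α(X) β(Y) - α(Y) β(X)` for 1-forms.
A `ℂ`-valued real-multilinear alternating `k`-form on `𝔤` is the same thing as an element of the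
`k`-th exterior power of the dual of the complexification of `𝔤`. -/
def wedge {p q : ℕ} (α : 𝔤 [⋀^Fin p]→ₗ[ℝ] A) (β : 𝔤 [⋀^Fin q]→ₗ[ℝ] A) :
    𝔤 [⋀^Fin (p + q)]→ₗ[ℝ] A :=
  ((p.factorial : ℝ) * (q.factorial : ℝ))⁻¹ •
    MultilinearMap.alternatization
      (((LinearMap.mul' ℝ A).compMultilinearMap
        (MultilinearMap.domCoprod (α : MultilinearMap ℝ (fun _ : Fin p => 𝔤) A)
          (β : MultilinearMap ℝ (fun _ : Fin q => 𝔤) A))).domDomCongr finSumFinEquiv)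

/-- The Chevalley–Eilenberg differential (trivial coefficients) in positive degrees:
`(dα)(v₀, …) = ∑_{i < j} (-1)^(i+j) α([vᵢ, vⱼ], v₀, …, v̂ᵢ, …, v̂ⱼ, …)`. In degree one this is
`dα(X, Y) = -α([X, Y])`. -/
def ceDiff {k : ℕ} (α : 𝔤 [⋀^Fin (k + 1)]→ₗ[ℝ] A) (v : Fin (k + 2) → 𝔤) : A :=
  ∑ j : Fin (k + 2), ∑ i : Fin (k + 1),
    if i.castSucc < j then
      (-1) ^ ((i : ℕ) + (j : ℕ)) *
        α (Fin.cons ⁅v i.castSucc, v j⁆ (i.removeNth (j.removeNth v)))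
    else 0

/-- A linear form, viewed as an alternating form of degree one. -/
def oneForm (α : 𝔤 →ₗ[ℝ] A) : 𝔤 [⋀^Fin 1]→ₗ[ℝ] A :=
  AlternatingMap.ofSubsingleton ℝ 𝔤 A (0 : Fin 1) α

/-- The wedge product of two linear forms. -/
def wedgeOne (α β : 𝔤 →ₗ[ℝ] A) : 𝔤 [⋀^Fin 2]→ₗ[ℝ] A :=
  wedge (oneForm α) (oneForm β)

/-- The complex conjugate of a complex-valued linear form. -/
def conjForm (α : 𝔤 →ₗ[ℝ] ℂ) : 𝔤 →ₗ[ℝ] ℂ :=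
  Complex.conjAe.toLinearMap ∘ₗ α

/-- A real form, viewed as a complex-valued form. -/
def complexify {k : ℕ} (α : 𝔤 [⋀^Fin k]→ₗ[ℝ] ℝ) : 𝔤 [⋀^Fin k]→ₗ[ℝ] ℂ :=
  (Algebra.linearMap ℝ ℂ).compAlternatingMap α

end Forms

section ComplexStructures

variable {𝔤 : Type*} [LieRing 𝔤] [LieAlgebra ℝ 𝔤]

/-- A complex structure on a real Lie algebra: `J² = -Id` and the Nijenhuis condition. -/
structure IsComplexStructure (J : 𝔤 →ₗ[ℝ] 𝔤) : Prop where
  sq : ∀ X, J (J X) = -X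
  nijenhuis : ∀ X Y, ⁅J X, J Y⁆ = J ⁅J X, Y⁆ + J ⁅X, J Y⁆ + ⁅X, Y⁆

/-- The ascending series `𝔤_l^J` adapted to `J`. -/
def adaptedSeries (J : 𝔤 →ₗ[ℝ] 𝔤) : ℕ → Submodule ℝ 𝔤
  | 0 => ⊥
  | l + 1 =>
    { carrier := {X | (∀ Y, ⁅X, Y⁆ ∈ adaptedSeries J l) ∧ ∀ Y, ⁅J X, Y⁆ ∈ adaptedSeries J l}
      add_mem' := by
        intro a b ha hb
        refine ⟨fun Y => ?_, fun Y => ?_⟩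
        · rw [add_lie]
          exact add_mem (ha.1 Y) (hb.1 Y)
        · rw [map_add, add_lie]
          exact add_mem (ha.2 Y) (hb.2 Y)
      zero_mem' := by
        refine ⟨fun Y => ?_, fun Y => ?_⟩ <;> simp
      smul_mem' := by
        intro c x hx
        refine ⟨fun Y => ?_, fun Y => ?_⟩
        · rw [smul_lie]
          exact Submodule.smul_mem _ c (hx.1 Y)
        · rw [map_smul, smul_lie]
          exact Submodule.smul_mem _ c (hx.2 Y) }

/-- `J` is nilpotent if its adapted ascending series reaches the whole Lie algebra. -/
def IsNilpotentStructure (J : 𝔤 →ₗ[ℝ] 𝔤) : Prop :=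
  ∃ l : ℕ, adaptedSeries J l = ⊤

/-- The action of `J` on complex-valued linear forms, `(Jα)(X) = -α(JX)`. -/
def dualAction (J : 𝔤 →ₗ[ℝ] 𝔤) : Module.End ℂ (𝔤 →ₗ[ℝ] ℂ) where
  toFun α := -(α ∘ₗ J)
  map_add' α β := by
    ext X
    simp [add_comm]
  map_smul' c α := by
    ext X
    simp

/-- The space `𝔤^{1,0}` of forms of type (1,0): the `i`-eigenspace of `J` on the complexified
dual. -/
def formsOneZero (J : 𝔤 →ₗ[ℝ] 𝔤) : Submodule ℂ (𝔤 →ₗ[ℝ] ℂ) :=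
  Module.End.eigenspace (dualAction J) Complex.I

end ComplexStructures

/-- A Hermitian structure `(J, g)` on a real Lie algebra: a complex structure together with a
compatible inner product. -/
structure HermitianStructure (𝔤 : Type*) [LieRing 𝔤] [LieAlgebra ℝ 𝔤] where
  J : 𝔤 →ₗ[ℝ] 𝔤
  isComplexStructure : IsComplexStructure J
  g : LinearMap.BilinForm ℝ 𝔤
  symm : ∀ X Y, g X Y = g Y X
  posDef : ∀ X, X ≠ 0 → 0 < g X X
  compatible : ∀ X Y, g (J X) (J Y) = g X Y

section Hermitian

variable {𝔤 : Type*} [LieRing 𝔤] [LieAlgebra ℝ 𝔤]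

/-- The fundamental form `F(X, Y) = g(X, JY)`. -/
def HermitianStructure.fundamentalForm (H : HermitianStructure 𝔤) : 𝔤 [⋀^Fin 2]→ₗ[ℝ] ℝ where
  toFun v := H.g (v 0) (H.J (v 1))
  map_update_add' := by
    intro _ v i x y
    fin_cases i <;> simp [Function.update]
  map_update_smul' := by
    intro _ v i c x
    fin_cases i <;> simp [Function.update]
  map_eq_zero_of_eq' := by
    intro v i j hij hne
    have h01 : v 0 = v 1 := by
      fin_cases i <;> fin_cases j <;> simp_all
    have h1 := H.compatible (v 1) (H.J (v 1))
    rw [H.isComplexStructure.sq, map_neg, H.symm] at h1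
    rw [h01]
    linarith

/-- `(J, F)` is balanced if `F² = F ∧ F` is closed. -/
def HermitianStructure.IsBalanced (H : HermitianStructure 𝔤) : Prop :=
  ceDiff (k := 3) (wedge (p := 2) (q := 2) H.fundamentalForm H.fundamentalForm) = 0

/-- The reduced structure equations with parameters `ε` and `c` (where `c = ±1` is the sign):
`dω¹ = 0`, `dω² = ω¹³ + ω^{1 3̄}`, `dω³ = i ε ω^{1 1̄} + c i (ω^{1 2̄} - ω^{2 1̄})`. -/
structure ReducedEquations (ε c : ℝ) (ω₁ ω₂ ω₃ : 𝔤 →ₗ[ℝ] ℂ) : Prop where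
  d_one : ceDiff (oneForm ω₁) = 0
  d_two : ceDiff (oneForm ω₂) = ⇑(wedgeOne ω₁ ω₃ + wedgeOne ω₁ (conjForm ω₃))
  d_three : ceDiff (oneForm ω₃) =
    ⇑((Complex.I * ε) • wedgeOne ω₁ (conjForm ω₁) +
      (c * Complex.I) • (wedgeOne ω₁ (conjForm ω₂) - wedgeOne ω₂ (conjForm ω₁)))

/-- The 2-form `i (r² ω^{1 1̄} + s² ω^{2 2̄} + t² ω^{3 3̄}) + u ω^{1 2̄} - ū ω^{2 1̄} + v ω^{2 3̄}
- v̄ ω^{3 2̄} + z ω^{1 3̄} - z̄ ω^{3 1̄}`. -/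
def coefficientForm (ω₁ ω₂ ω₃ : 𝔤 →ₗ[ℝ] ℂ) (r s t : ℝ) (u v z : ℂ) : 𝔤 [⋀^Fin 2]→ₗ[ℝ] ℂ :=
  Complex.I • (((r : ℂ) ^ 2) • wedgeOne ω₁ (conjForm ω₁) +
      ((s : ℂ) ^ 2) • wedgeOne ω₂ (conjForm ω₂) +
      ((t : ℂ) ^ 2) • wedgeOne ω₃ (conjForm ω₃)) +
    u • wedgeOne ω₁ (conjForm ω₂) - conj u • wedgeOne ω₂ (conjForm ω₁) +
    v • wedgeOne ω₂ (conjForm ω₃) - conj v • wedgeOne ω₃ (conjForm ω₂) +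
    z • wedgeOne ω₁ (conjForm ω₃) - conj z • wedgeOne ω₃ (conjForm ω₁)

end Hermitian

/-- The underlying space of the Lie algebra `𝔫 = (0,0,0,12,23,14-35)`; the coordinates of a vector
are its values under the dual basis `e¹, …, e⁶` (indexed here from `0` to `5`). -/
def LieN : Type := Fin 6 → ℝ

instance : AddCommGroup LieN := inferInstanceAs (AddCommGroup (Fin 6 → ℝ))

instance : Module ℝ LieN := inferInstanceAs (Module ℝ (Fin 6 → ℝ))

/-- The bracket for which `de¹ = de² = de³ = 0`, `de⁴ = e¹ ∧ e²`, `de⁵ = e² ∧ e³`,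
`de⁶ = e¹ ∧ e⁴ - e³ ∧ e⁵`, where `de(X, Y) = -e([X, Y])`. -/
def LieN.bracket (x y : Fin 6 → ℝ) : Fin 6 → ℝ :=
  ![0, 0, 0,
    -(x 0 * y 1 - x 1 * y 0),
    -(x 1 * y 2 - x 2 * y 1),
    -((x 0 * y 3 - x 3 * y 0) - (x 2 * y 4 - x 4 * y 2))]

theorem LieN.bracket_add_left (x y z : Fin 6 → ℝ) :
    bracket (x + y) z = bracket x z + bracket y z := by
  funext i
  fin_cases i <;> simp [bracket] <;> ring

theorem LieN.bracket_add_right (x y z : Fin 6 → ℝ) :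
    bracket x (y + z) = bracket x y + bracket x z := by
  funext i
  fin_cases i <;> simp [bracket] <;> ring

theorem LieN.bracket_self (x : Fin 6 → ℝ) : bracket x x = 0 := by
  funext i
  fin_cases i <;> simp [bracket, mul_comm]

theorem LieN.bracket_leibniz (x y z : Fin 6 → ℝ) :
    bracket x (bracket y z) = bracket (bracket x y) z + bracket y (bracket x z) := by
  funext i
  fin_cases i <;> simp [bracket] <;> ring

theorem LieN.bracket_smul_right (c : ℝ) (x y : Fin 6 → ℝ) :
    bracket x (c • y) = c • bracket x y := by
  funext i
  fin_cases i <;> simp [bracket] <;> ring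

instance : LieRing LieN where
  bracket x y := LieN.bracket x y
  add_lie := LieN.bracket_add_left
  lie_add := LieN.bracket_add_right
  lie_self := LieN.bracket_self
  leibniz_lie := LieN.bracket_leibniz

instance : LieAlgebra ℝ LieN where
  lie_smul := LieN.bracket_smul_right

end

end NilpotentBalanced

/-! Take a nonzero central vector `X` and set `U = J X`. The Nijenhuis condition makes `ad U`
commute with `J`, so it is complex-linear and nilpotent. If no nonzero central vector has central
image under `J`, then `ad U ≠ 0`; choosing `T` with `Y = ⁅U, T⁆ ≠ 0` and `⁅U, Y⁆ = 0` makes `X, U,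
Y, J Y, T, J T` independent (`exists_frame`), so the dimension is at least six. Applied to the
quotient by the stable term of the adapted series, this forces that term to vanish. Hence the
hypothesis on central vectors holds in the Lie algebra itself, and these six vectors form a basis.

Nilpotency and the Nijenhuis condition then determine the remaining brackets up to a few real
parameters. A change of `T` and a rescaling leave only a sign `c` and a real `ε`
(`exists_reducedFrame`). Dually, these are the reduced structure equations.

Evaluating `d(F ∧ F)` on four 5-tuples of frame vectors gives `ε = 0` and three linear relations on
the metric (`HermitianStructure.IsBalanced.conditions`). Since the coefficients of `2F` are the
values of `g` on the frame, these are the relations on `u, v, z`. The argument works for any basis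
with reduced equations, so it yields both (b) and (c). With `ε = 0`, real and imaginary parts of the
basis, rescaled, give the structure equations of `𝔫`. -/

namespace NilpotentBalanced

/-! ### Explicit values of differentials and wedge products -/

section Evaluation

variable {𝔤 : Type*} [LieRing 𝔤] [LieAlgebra ℝ 𝔤]
variable {A : Type*} [CommRing A] [Algebra ℝ A]

theorem ceDiff_oneForm_apply (α : 𝔤 →ₗ[ℝ] A) (X Y : 𝔤) :
    ceDiff (oneForm α) ![X, Y] = -α ⁅X, Y⁆ := by
  simp [ceDiff, oneForm, Fin.sum_univ_succ]

theorem wedgeOne_apply (α β : 𝔤 →ₗ[ℝ] A) (X Y : 𝔤) :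
    wedgeOne α β ![X, Y] = α X * β Y - α Y * β X := by
  simp only [wedgeOne, wedge, AlternatingMap.smul_apply, MultilinearMap.alternatization_apply]
  rw [← Equiv.sum_comp (Equiv.Perm.decomposeFin (n := 1)).symm, Fintype.sum_prod_type]
  simp [Fin.sum_univ_succ, oneForm, finSumFinEquiv, Equiv.Perm.decomposeFin, sub_eq_add_neg]

theorem ceDiff_three_apply (α : 𝔤 [⋀^Fin 4]→ₗ[ℝ] A) (a b c d e : 𝔤) :
    ceDiff (k := 3) α ![a, b, c, d, e] =
      -α ![⁅a, b⁆, c, d, e] + α ![⁅a, c⁆, b, d, e] - α ![⁅a, d⁆, b, c, e] + α ![⁅a, e⁆, b, c, d]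
      - α ![⁅b, c⁆, a, d, e] + α ![⁅b, d⁆, a, c, e] - α ![⁅b, e⁆, a, c, d]
      - α ![⁅c, d⁆, a, b, e] + α ![⁅c, e⁆, a, b, d] - α ![⁅d, e⁆, a, b, c] := by
  have key : ∀ (i : Fin 4) (j : Fin 5) (w : Fin 4 → 𝔤) (x y : 𝔤),
      ![a, b, c, d, e] i.castSucc = x → ![a, b, c, d, e] j = y →
      (∀ k, i.removeNth (j.removeNth ![a, b, c, d, e]) k = w k.succ) → w 0 = ⁅x, y⁆ →
      α (Fin.cons ⁅(![a, b, c, d, e] : Fin 5 → 𝔤) i.castSucc, ![a, b, c, d, e] j⁆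
        (i.removeNth (j.removeNth (![a, b, c, d, e] : Fin 5 → 𝔤)))) = α w := by
    intro i j w x y hx hy hk h0
    congr 1
    funext k
    refine Fin.cases ?_ (fun k => ?_) k
    · simp [hx, hy, h0]
    · simp [hk]
  have h : ceDiff (k := 3) α ![a, b, c, d, e] = ∑ j : Fin 5, ∑ i : Fin 4,
      if i.castSucc < j then (-1) ^ ((i : ℕ) + (j : ℕ)) *
        α (Fin.cons ⁅(![a, b, c, d, e] : Fin 5 → 𝔤) i.castSucc, ![a, b, c, d, e] j⁆
          (i.removeNth (j.removeNth (![a, b, c, d, e] : Fin 5 → 𝔤)))) else 0 := rfl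
  rw [h]
  simp only [Fin.sum_univ_five, Fin.sum_univ_four]
  rw [key 0 1 ![⁅a, b⁆, c, d, e] a b rfl rfl (by intro k; fin_cases k <;> rfl) rfl,
    key 0 2 ![⁅a, c⁆, b, d, e] a c rfl rfl (by intro k; fin_cases k <;> rfl) rfl,
    key 1 2 ![⁅b, c⁆, a, d, e] b c rfl rfl (by intro k; fin_cases k <;> rfl) rfl,
    key 0 3 ![⁅a, d⁆, b, c, e] a d rfl rfl (by intro k; fin_cases k <;> rfl) rfl,
    key 1 3 ![⁅b, d⁆, a, c, e] b d rfl rfl (by intro k; fin_cases k <;> rfl) rfl,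
    key 2 3 ![⁅c, d⁆, a, b, e] c d rfl rfl (by intro k; fin_cases k <;> rfl) rfl,
    key 0 4 ![⁅a, e⁆, b, c, d] a e rfl rfl (by intro k; fin_cases k <;> rfl) rfl,
    key 1 4 ![⁅b, e⁆, a, c, d] b e rfl rfl (by intro k; fin_cases k <;> rfl) rfl,
    key 2 4 ![⁅c, e⁆, a, b, d] c e rfl rfl (by intro k; fin_cases k <;> rfl) rfl,
    key 3 4 ![⁅d, e⁆, a, b, c] d e rfl rfl (by intro k; fin_cases k <;> rfl) rfl]
  simp [Fin.lt_def]
  ring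

theorem sum_perm_fin_four {M : Type*} [AddCommGroup M] (f : Fin 4 → Fin 4 → Fin 4 → Fin 4 → M) :
    ∑ σ : Equiv.Perm (Fin 4), Equiv.Perm.sign σ • f (σ 0) (σ 1) (σ 2) (σ 3) =
      f 0 1 2 3 - f 0 1 3 2 - f 0 2 1 3 + f 0 2 3 1 + f 0 3 1 2 - f 0 3 2 1
      - f 1 0 2 3 + f 1 0 3 2 + f 1 2 0 3 - f 1 2 3 0 - f 1 3 0 2 + f 1 3 2 0
      + f 2 0 1 3 - f 2 0 3 1 - f 2 1 0 3 + f 2 1 3 0 + f 2 3 0 1 - f 2 3 1 0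
      - f 3 0 1 2 + f 3 0 2 1 + f 3 1 0 2 - f 3 1 2 0 - f 3 2 0 1 + f 3 2 1 0 := by
  rw [← Equiv.sum_comp (Equiv.Perm.decomposeFin (n := 3)).symm, Fintype.sum_prod_type]
  simp only [← Equiv.sum_comp (Equiv.Perm.decomposeFin (n := 2)).symm, Fintype.sum_prod_type]
  simp only [← Equiv.sum_comp (Equiv.Perm.decomposeFin (n := 1)).symm, Fintype.sum_prod_type]
  simp only [Fin.sum_univ_four, Fin.sum_univ_three, Fin.sum_univ_two, Finset.univ_unique,
    Finset.sum_singleton, Equiv.Perm.decomposeFin.symm_sign]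
  generalize hρ : (default : Equiv.Perm (Fin 1)) = ρ
  obtain rfl : ρ = 1 := Subsingleton.elim _ _
  have e : ∀ (p : Fin 4) (q : Fin 3) (r : Fin 2),
      let τ := Equiv.Perm.decomposeFin.symm (p, Equiv.Perm.decomposeFin.symm
        (q, Equiv.Perm.decomposeFin.symm (r, (1 : Equiv.Perm (Fin 1)))))
      f (τ 0) (τ 1) (τ 2) (τ 3) = f p (Equiv.swap 0 p q.succ)
        (Equiv.swap 0 p (Equiv.swap 0 q r.succ).succ)
        (Equiv.swap 0 p (Equiv.swap 0 q (Equiv.swap 0 r 1).succ).succ) := by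
    intro p q r τ
    have t0 : τ 0 = p := Equiv.Perm.decomposeFin_symm_apply_zero _ _
    have t1 : τ 1 = Equiv.swap 0 p q.succ := by
      change Equiv.Perm.decomposeFin.symm _ (Fin.succ 0) = _
      rw [Equiv.Perm.decomposeFin_symm_apply_succ, Equiv.Perm.decomposeFin_symm_apply_zero]
    have t2 : τ 2 = Equiv.swap 0 p (Equiv.swap 0 q r.succ).succ := by
      change Equiv.Perm.decomposeFin.symm _ (Fin.succ (Fin.succ 0)) = _
      rw [Equiv.Perm.decomposeFin_symm_apply_succ, Equiv.Perm.decomposeFin_symm_apply_succ,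
        Equiv.Perm.decomposeFin_symm_apply_zero]
    have t3 : τ 3 = Equiv.swap 0 p (Equiv.swap 0 q (Equiv.swap 0 r 1).succ).succ := by
      change Equiv.Perm.decomposeFin.symm _ (Fin.succ (Fin.succ (Fin.succ 0))) = _
      rw [Equiv.Perm.decomposeFin_symm_apply_succ, Equiv.Perm.decomposeFin_symm_apply_succ,
        Equiv.Perm.decomposeFin_symm_apply_succ]
      rfl
    rw [t0, t1, t2, t3]
  simp only [e]
  have c1 : ∀ p q : Fin 4, ∀ r, Equiv.swap p q r = if r = p then q else if r = q then p else r :=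
    fun _ _ _ => Equiv.swap_apply_def _ _ _
  have c2 : ∀ p q : Fin 3, ∀ r, Equiv.swap p q r = if r = p then q else if r = q then p else r :=
    fun _ _ _ => Equiv.swap_apply_def _ _ _
  have c3 : ∀ p q : Fin 2, ∀ r, Equiv.swap p q r = if r = p then q else if r = q then p else r :=
    fun _ _ _ => Equiv.swap_apply_def _ _ _
  simp [c1, c2, c3, Fin.ext_iff]
  abel

/-- The 24 permutations fall into three pairings with eight equal terms each; dividing by `2! 2!`
leaves the factor 2. -/
theorem wedge_two_two_apply (F : 𝔤 [⋀^Fin 2]→ₗ[ℝ] ℝ) (a b c d : 𝔤) :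
    wedge (p := 2) (q := 2) F F ![a, b, c, d] =
      2 * (F ![a, b] * F ![c, d] - F ![a, c] * F ![b, d] + F ![a, d] * F ![b, c]) := by
  have swap : ∀ x y, F ![y, x] = -F ![x, y] := by
    intro x y
    have := F.map_swap ![x, y] (i := 0) (j := 1) (by decide)
    rw [← this]; congr 1; funext i; fin_cases i <;> simp
  have ext2 : ∀ w : Fin 2 → 𝔤, F w = F ![w 0, w 1] := by
    intro w; congr 1; funext i; fin_cases i <;> simp
  have h := sum_perm_fin_four (fun i j k l => F ![![a, b, c, d] i, ![a, b, c, d] j] *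
    F ![![a, b, c, d] k, ![a, b, c, d] l])
  have e : wedge (p := 2) (q := 2) F F ![a, b, c, d] = (4 : ℝ)⁻¹ *
      ∑ σ : Equiv.Perm (Fin 4), Equiv.Perm.sign σ •
      (F ![![a, b, c, d] (σ 0), ![a, b, c, d] (σ 1)] *
        F ![![a, b, c, d] (σ 2), ![a, b, c, d] (σ 3)]) := by
    simp only [wedge, AlternatingMap.smul_apply, MultilinearMap.alternatization_apply]
    rw [smul_eq_mul]
    congr 1
    · norm_num [Nat.factorial]
    · refine Finset.sum_congr rfl fun σ _ => ?_
      simp only [MultilinearMap.domDomCongr_apply, LinearMap.compMultilinearMap_apply,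
        MultilinearMap.domCoprod_apply, LinearMap.mul'_apply, AlternatingMap.coe_multilinearMap]
      exact congrArg _ (congrArg₂ (· * ·) (ext2 _) (ext2 _))
  rw [e, h]
  simp only [swap a b, swap a c, swap a d, swap b c, swap b d, swap c d, Matrix.cons_val]
  ring

end Evaluation
-- Nilpotency arguments and the six independent vectors
section Frame

variable {𝔤 : Type*} [LieRing 𝔤] [LieAlgebra ℝ 𝔤]

/-- In a nilpotent Lie algebra, a set contained in `K` plus the span of its own brackets
lies in the ideal `K`. -/
theorem subset_of_forall_lie_mem [LieRing.IsNilpotent 𝔤] (A : Set 𝔤) (K : Submodule ℝ 𝔤)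
    (hK : ∀ k ∈ K, ∀ x : 𝔤, ⁅k, x⁆ ∈ K)
    (hA : ∀ L : Submodule ℝ 𝔤, K ≤ L → (∀ s ∈ A, ∀ x : 𝔤, ⁅s, x⁆ ∈ L) → ∀ s ∈ A, s ∈ L) :
    ∀ s ∈ A, s ∈ K := by
  obtain ⟨n, hn⟩ := LieModule.IsNilpotent.nilpotent ℝ 𝔤 𝔤
  -- If `A` lies in `Cᵐ + K`, then its brackets lie in `Cᵐ⁺¹ + K`, hence so does `A`; the lower
  -- central series `Cᵐ` ends at zero.
  have h : ∀ m, ∀ s ∈ A, s ∈ (LieModule.lowerCentralSeries ℝ 𝔤 𝔤 m).toSubmodule ⊔ K := by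
    intro m
    induction m with
    | zero => intro s _; simp
    | succ m ih =>
      refine hA _ le_sup_right fun s hs x => ?_
      obtain ⟨c, hc, k, hk, rfl⟩ := Submodule.mem_sup.1 (ih s hs)
      rw [add_lie]
      refine add_mem (Submodule.mem_sup_left ?_) (Submodule.mem_sup_right (hK k hk x))
      rw [← lie_skew]
      refine neg_mem ?_
      rw [LieSubmodule.mem_toSubmodule, LieModule.lowerCentralSeries_succ]
      exact LieSubmodule.lie_mem_lie (LieSubmodule.mem_top x) hc
  intro s hs
  simpa [hn] using h n s hs

theorem eq_zero_of_forall_lie_mem [LieRing.IsNilpotent 𝔤] (A : Set 𝔤)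
    (hA : ∀ L : Submodule ℝ 𝔤, (∀ s ∈ A, ∀ x : 𝔤, ⁅s, x⁆ ∈ L) → ∀ s ∈ A, s ∈ L) :
    ∀ s ∈ A, s = 0 := by
  intro s hs
  have := subset_of_forall_lie_mem A ⊥ (by simp) (fun L _ h => hA L h) s hs
  simpa using this

variable {J : 𝔤 →ₗ[ℝ] 𝔤}

/-- Two of the four Nijenhuis terms contain `X` and vanish; what remains says that `ad (J X)`
commutes with `J`. -/
theorem IsComplexStructure.lie_map_of_central (hJ : IsComplexStructure J) {X : 𝔤}
    (hX : ∀ Y : 𝔤, ⁅X, Y⁆ = 0) (Y : 𝔤) : ⁅J X, J Y⁆ = J ⁅J X, Y⁆ := by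
  simpa [hX] using hJ.nijenhuis X Y

theorem IsComplexStructure.eq_zero_of_smul_add_smul (hJ : IsComplexStructure J) {X : 𝔤}
    (hX : X ≠ 0) {a b : ℝ} (h : a • X + b • J X = 0) : a = 0 ∧ b = 0 := by
  have h2 : J (a • X + b • J X) = 0 := by rw [h, map_zero]
  rw [map_add, map_smul, map_smul, hJ.sq] at h2
  have h3 : (a * a + b * b) • X = 0 := by
    have : (a * a + b * b) • X = a • (a • X + b • J X) - b • (a • J X + b • -X) := by module
    rw [this, h, h2]; simp
  have h4 := (smul_eq_zero.1 h3).resolve_right hX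
  constructor <;> nlinarith [mul_self_nonneg a, mul_self_nonneg b]

theorem exists_frame [LieRing.IsNilpotent 𝔤] [Nontrivial 𝔤] (hJ : IsComplexStructure J)
    (h0 : ∀ X : 𝔤, (∀ Y : 𝔤, ⁅X, Y⁆ = 0) → (∀ Y : 𝔤, ⁅J X, Y⁆ = 0) → X = 0) :
    ∃ X T : 𝔤, (∀ Y : 𝔤, ⁅X, Y⁆ = 0) ∧ ⁅J X, ⁅J X, T⁆⁆ = 0 ∧
      LinearIndependent ℝ ![X, J X, ⁅J X, T⁆, J ⁅J X, T⁆, T, J T] := by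
  have := LieModule.nontrivial_max_triv_of_isNilpotent ℝ 𝔤 𝔤
  obtain ⟨⟨X, hXc⟩, hX0⟩ := exists_ne (0 : LieModule.maxTrivSubmodule ℝ 𝔤 𝔤)
  have hX0 : X ≠ 0 := fun h => hX0 (Subtype.ext h)
  have hX : ∀ Y : 𝔤, ⁅X, Y⁆ = 0 := fun Y => by
    rw [← lie_skew, hXc Y, neg_zero]
  obtain ⟨T₁, hT₁⟩ : ∃ T : 𝔤, ⁅J X, T⁆ ≠ 0 := by
    by_contra! h
    exact hX0 (h0 X hX h)
  obtain ⟨T, hT, hT0⟩ : ∃ T : 𝔤, ⁅J X, T⁆ ≠ 0 ∧ ⁅J X, ⁅J X, T⁆⁆ = 0 := by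
    obtain ⟨k, hk⟩ := LieModule.exists_forall_pow_toEnd_eq_zero ℝ 𝔤 𝔤
    by_contra! h
    have : ∀ n, ⁅J X, ((LieModule.toEnd ℝ 𝔤 𝔤 (J X)) ^ n) T₁⁆ ≠ 0 := by
      intro n
      induction n with
      | zero => simpa using hT₁
      | succ n ih =>
        rw [pow_succ', Module.End.mul_apply]
        exact h _ ih
    exact this k (by simp [hk])
  refine ⟨X, T, hX, hT0, ?_⟩
  have hD := hJ.lie_map_of_central hX
  rw [Fintype.linearIndependent_iff]
  intro g hg
  simp only [Fin.sum_univ_six, Matrix.cons_val] at hg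
  -- Applying `ad (J X)` to the relation kills all but the last two terms.
  have h45 : g 4 = 0 ∧ g 5 = 0 := by
    apply hJ.eq_zero_of_smul_add_smul hT
    have h := congrArg (fun v => ⁅J X, v⁆) hg
    have hXX : ⁅J X, X⁆ = 0 := by rw [← lie_skew, hX, neg_zero]
    simpa [hXX, hT0, hD] using h
  rw [h45.1, h45.2, zero_smul, zero_smul, add_zero, add_zero] at hg
  -- Otherwise a complex multiple of `X` lies in the image of `ad (J X)`. Dividing by the scalar `g
  -- 0 + g 1 J` gives `⁅J X, S⁆ = X`, so `⁅J X, J S⁆ = J X`, which nilpotency forbids.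
  have h01 : g 0 = 0 ∧ g 1 = 0 := by
    by_contra hne
    have hpos : g 0 * g 0 + g 1 * g 1 ≠ 0 := by
      intro h
      apply hne
      constructor <;> nlinarith [mul_self_nonneg (g 0), mul_self_nonneg (g 1)]
    set S₀ := -(g 2 • T + g 3 • J T) with hS₀
    have e : ⁅J X, S₀⁆ = g 0 • X + g 1 • J X := by
      rw [hS₀, lie_neg, lie_add, lie_smul, lie_smul, hD, neg_eq_iff_add_eq_zero, ← hg]
      abel
    set S := (g 0 * g 0 + g 1 * g 1)⁻¹ • (g 0 • S₀ - g 1 • J S₀) with hS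
    have eS : ⁅J X, S⁆ = X := by
      rw [hS, lie_smul, lie_sub, lie_smul, lie_smul, hD, e, map_add, map_smul, map_smul, hJ.sq]
      have : g 0 • (g 0 • X + g 1 • J X) - g 1 • (g 0 • J X + g 1 • -X) =
        (g 0 * g 0 + g 1 * g 1) • X := by module
      rw [this, smul_smul, inv_mul_cancel₀ hpos, one_smul]
    have hJX : J X = 0 := by
      refine eq_zero_of_forall_lie_mem {J X} (fun L hL => ?_) (J X) rfl
      rintro _ rfl
      have := hL _ rfl (J S)
      rwa [hD, eS] at this
    apply hX0
    rw [← neg_neg X, ← hJ.sq X, hJX, map_zero, neg_zero]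
  rw [h01.1, h01.2, zero_smul, zero_smul, zero_add, zero_add] at hg
  have h23 := hJ.eq_zero_of_smul_add_smul hT hg
  intro i
  fin_cases i
  exacts [h01.1, h01.2, h23.1, h23.2, h45.1, h45.2]

theorem adaptedSeries_le_succ (J : 𝔤 →ₗ[ℝ] 𝔤) (l : ℕ) :
    adaptedSeries J l ≤ adaptedSeries J (l + 1) := by
  induction l with
  | zero => exact bot_le
  | succ l ih => exact fun X hX => ⟨fun Y => ih (hX.1 Y), fun Y => ih (hX.2 Y)⟩

theorem IsComplexStructure.map_mem_adaptedSeries (hJ : IsComplexStructure J) {l : ℕ} {X : 𝔤}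
    (hX : X ∈ adaptedSeries J l) : J X ∈ adaptedSeries J l := by
  cases l with
  | zero =>
    have : X = 0 := hX
    rw [this, map_zero]
    exact zero_mem _
  | succ l =>
    refine ⟨hX.2, fun Y => ?_⟩
    rw [hJ.sq, neg_lie]
    exact neg_mem (hX.1 Y)

theorem lie_mem_adaptedSeries (J : 𝔤 →ₗ[ℝ] 𝔤) {l : ℕ} {X : 𝔤}
    (hX : X ∈ adaptedSeries J l) (Y : 𝔤) : ⁅Y, X⁆ ∈ adaptedSeries J l := by
  cases l with
  | zero =>
    have : X = 0 := hX
    rw [this, lie_zero]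
    exact zero_mem _
  | succ l =>
    rw [← lie_skew]
    exact neg_mem (adaptedSeries_le_succ J l (hX.1 Y))

/-- The ideal `𝔤_l^J`. -/
def adaptedIdeal (J : 𝔤 →ₗ[ℝ] 𝔤) (l : ℕ) : LieIdeal ℝ 𝔤 :=
  { adaptedSeries J l with lie_mem := fun {Y _} hX => lie_mem_adaptedSeries J hX Y }

/-- In dimension six, a non-nilpotent complex structure leaves no `J`-invariant central plane. -/
theorem eq_zero_of_central_of_not_isNilpotentStructure [LieRing.IsNilpotent 𝔤]
    (hdim : Module.finrank ℝ 𝔤 = 6) (hJ : IsComplexStructure J) (hn : ¬ IsNilpotentStructure J)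
    (X : 𝔤) (hX : ∀ Y : 𝔤, ⁅X, Y⁆ = 0) (hJX : ∀ Y : 𝔤, ⁅J X, Y⁆ = 0) : X = 0 := by
  have : FiniteDimensional ℝ 𝔤 := Module.finite_of_finrank_pos (by omega)
  -- Stability of the series at `l` means that in the quotient by its `l`-th term no nonzero central
  -- vector has central image under `J`.
  obtain ⟨l, hl⟩ := WellFoundedGT.monotone_chain_condition
    (⟨adaptedSeries J, monotone_nat_of_le_succ (adaptedSeries_le_succ J)⟩ :
      ℕ →o Submodule ℝ 𝔤)
  have hl1 : adaptedSeries J (l + 1) = adaptedSeries J l := (hl (l + 1) (by omega)).symm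
  let I : LieIdeal ℝ 𝔤 := adaptedIdeal J l
  have hI : ∀ Z : 𝔤, (LieSubmodule.Quotient.mk Z : 𝔤 ⧸ I) = 0 ↔ Z ∈ adaptedSeries J l := fun Z =>
    LieSubmodule.Quotient.mk_eq_zero'
  let π : 𝔤 →ₗ⁅ℝ⁆ 𝔤 ⧸ I :=
    { (LieSubmodule.Quotient.mk' I : 𝔤 →ₗ[ℝ] 𝔤 ⧸ I) with
      map_lie' := fun {x y} => LieSubmodule.Quotient.mk_bracket _ x y }
  have hπ : Function.Surjective π := LieSubmodule.Quotient.surjective_mk' I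
  have hπ0 : ∀ Z : 𝔤, π Z = 0 ↔ Z ∈ adaptedSeries J l := hI
  have : LieRing.IsNilpotent (𝔤 ⧸ I) := hπ.lieAlgebra_isNilpotent
  have : Nontrivial (𝔤 ⧸ I) := by
    have : adaptedSeries J l ≠ ⊤ := fun h => hn ⟨l, h⟩
    obtain ⟨Z, -, hZ⟩ := SetLike.exists_of_lt (lt_top_iff_ne_top.2 this)
    exact ⟨π Z, 0, fun h => hZ ((hπ0 Z).1 h)⟩
  let J' : (𝔤 ⧸ I) →ₗ[ℝ] 𝔤 ⧸ I := Submodule.mapQ (adaptedSeries J l) (adaptedSeries J l) J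
    fun Z hZ => hJ.map_mem_adaptedSeries hZ
  have hJ'π : ∀ Z, J' (π Z) = π (J Z) := fun Z => rfl
  have hJ' : IsComplexStructure J' := by
    constructor
    · intro Z
      obtain ⟨Z, rfl⟩ := hπ Z
      rw [hJ'π, hJ'π, hJ.sq, map_neg]
    · intro Z W
      obtain ⟨Z, rfl⟩ := hπ Z
      obtain ⟨W, rfl⟩ := hπ W
      simp only [hJ'π, ← LieHom.map_lie, ← map_add, hJ.nijenhuis]
  obtain ⟨_, _, -, -, hli⟩ := exists_frame hJ' (by
    intro Z hZ hJZ
    obtain ⟨Z, rfl⟩ := hπ Z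
    rw [hπ0, ← hl1]
    refine ⟨fun Y => ?_, fun Y => ?_⟩
    · rw [← hπ0, LieHom.map_lie]
      exact hZ _
    · rw [← hπ0, LieHom.map_lie]
      exact hJZ (π Y))
  have h6 := hli.fintype_card_le_finrank
  rw [Fintype.card_fin] at h6
  have hq : Module.finrank ℝ (𝔤 ⧸ I) + Module.finrank ℝ (adaptedSeries J l) =
    Module.finrank ℝ 𝔤 := Submodule.finrank_quotient_add_finrank (adaptedSeries J l)
  have hbot : adaptedSeries J l = ⊥ := Submodule.finrank_eq_zero.1 (by omega)
  have hmem : X ∈ adaptedSeries J (l + 1) := by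
    refine ⟨fun Y => ?_, fun Y => ?_⟩
    · rw [hX]
      exact zero_mem _
    · rw [hJX]
      exact zero_mem _
  rwa [hl1, hbot, Submodule.mem_bot] at hmem

end Frame
-- Determining the brackets and normalizing the frame
section Classification

variable {𝔤 : Type*} [LieRing 𝔤] [LieAlgebra ℝ 𝔤] {J : 𝔤 →ₗ[ℝ] 𝔤}

/-- A `J`-adapted real basis `E₁, JE₁, E₂, JE₂, E₃, JE₃` whose brackets are dual to the reduced
structure equations. -/
structure ReducedFrame (J : 𝔤 →ₗ[ℝ] 𝔤) (ε c : ℝ) (E₁ E₂ E₃ : 𝔤) : Prop where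
  linearIndependent : LinearIndependent ℝ ![E₁, J E₁, E₂, J E₂, E₃, J E₃]
  lie_one_Jone : ⁅E₁, J E₁⁆ = (2 * ε) • E₃
  lie_one_two : ⁅E₁, E₂⁆ = (2 * c) • J E₃
  lie_Jone_Jtwo : ⁅J E₁, J E₂⁆ = (2 * c) • J E₃
  lie_one_Jtwo : ⁅E₁, J E₂⁆ = 0
  lie_Jone_two : ⁅J E₁, E₂⁆ = 0
  lie_two_Jtwo : ⁅E₂, J E₂⁆ = 0
  lie_one_three : ⁅E₁, E₃⁆ = (-2 : ℝ) • E₂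
  lie_Jone_three : ⁅J E₁, E₃⁆ = (-2 : ℝ) • J E₂
  lie_two_three : ⁅E₂, E₃⁆ = 0
  lie_Jtwo_three : ⁅J E₂, E₃⁆ = 0
  lie_Jthree : ∀ Z : 𝔤, ⁅J E₃, Z⁆ = 0

theorem exists_reducedFrame [LieRing.IsNilpotent 𝔤] (hdim : Module.finrank ℝ 𝔤 = 6)
    (hJ : IsComplexStructure J) (hn : ¬ IsNilpotentStructure J) :
    ∃ (ε c : ℝ) (E₁ E₂ E₃ : 𝔤), (c = 1 ∨ c = -1) ∧ ReducedFrame J ε c E₁ E₂ E₃ := by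
  have h0 := eq_zero_of_central_of_not_isNilpotentStructure hdim hJ hn
  have : Nontrivial 𝔤 := Module.nontrivial_of_finrank_pos (R := ℝ) (by omega)
  obtain ⟨X, T, hX, hUY, hli⟩ := exists_frame hJ h0
  have hD := hJ.lie_map_of_central hX
  have hspan : ∀ v : 𝔤, ∃ a b c d e f : ℝ,
      v = a • X + b • J X + c • ⁅J X, T⁆ + d • J ⁅J X, T⁆ + e • T + f • J T := by
    intro v
    let B := basisOfLinearIndependentOfCardEqFinrank hli (by simp [hdim])
    have := B.sum_repr v
    simp only [Fin.sum_univ_six, B, coe_basisOfLinearIndependentOfCardEqFinrank,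
      Matrix.cons_val] at this
    exact ⟨_, _, _, _, _, _, this.symm⟩
  have hind : ∀ a b c d e f : ℝ,
      a • X + b • J X + c • ⁅J X, T⁆ + d • J ⁅J X, T⁆ + e • T + f • J T = 0 →
      a = 0 ∧ b = 0 ∧ c = 0 ∧ d = 0 ∧ e = 0 ∧ f = 0 := by
    intro a b c d e f h
    rw [Fintype.linearIndependent_iff] at hli
    have := hli ![a, b, c, d, e, f] (by simpa [Fin.sum_univ_six] using h)
    exact ⟨this 0, this 1, this 2, this 3, this 4, this 5⟩
  have hUJT : ⁅J X, J T⁆ = J ⁅J X, T⁆ := hD T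
  have hUJY : ⁅J X, J ⁅J X, T⁆⁆ = 0 := by rw [hD, hUY, map_zero]
  obtain ⟨Y, hY⟩ : ∃ Y, Y = ⁅J X, T⁆ := ⟨_, rfl⟩
  rw [← hY] at hUY hspan hind hUJT hUJY
  have hUT := hY.symm
  obtain ⟨U, hU⟩ : ∃ U, U = J X := ⟨_, rfl⟩
  have hJU : J U = -X := by rw [hU, hJ.sq]
  rw [← hU] at hUY hspan hind hUJT hUJY hUT hD
  clear hY hli
  have hXr : ∀ Z : 𝔤, ⁅Z, X⁆ = 0 := fun Z => by rw [← lie_skew, hX, neg_zero]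
  have hJY : J (J Y) = -Y := hJ.sq Y
  have hY0 : Y ≠ 0 := by
    rintro rfl
    have := hind 0 0 1 0 0 0 (by simp)
    norm_num at this
  -- the image and the kernel of `ad U`
  have him : ∀ v, ∃ e f : ℝ, ⁅U, v⁆ = e • Y + f • J Y := by
    intro v
    obtain ⟨a, b, c, d, e, f, rfl⟩ := hspan v
    exact ⟨e, f, by simp [hXr, hUY, hUJY, hUT, hUJT]⟩
  have hker : ∀ v, ⁅U, v⁆ = 0 → ∃ a b c d : ℝ, v = a • X + b • U + c • Y + d • J Y := by
    intro v hv
    obtain ⟨a, b, c, d, e, f, rfl⟩ := hspan v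
    obtain ⟨rfl, rfl⟩ : e = 0 ∧ f = 0 :=
      hJ.eq_zero_of_smul_add_smul hY0 (by simpa [hXr, hUY, hUJY, hUT, hUJT] using hv)
    exact ⟨a, b, c, d, by simp⟩
  -- This bracket equals `⁅U, ⁅Y, J T⁆⁆`, so it is `e Y + f J Y`. Bracketing with `J Y` and `Y`
  -- returns `e` and `-f` times itself, so by nilpotency it vanishes.
  have hYJY : ⁅Y, J Y⁆ = 0 := by
    obtain ⟨e, f, hm⟩ := him ⁅Y, J T⁆
    rw [leibniz_lie, hUY, zero_lie, zero_add, hUJT] at hm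
    by_contra hne
    refine hne (eq_zero_of_forall_lie_mem {⁅Y, J Y⁆} (fun L hL => ?_) _ rfl)
    rintro _ rfl
    have h1 := hL _ rfl (J Y)
    have h2 := hL _ rfl Y
    nth_rewrite 1 [hm] at h1 h2
    have h2' : ⁅e • Y + f • J Y, Y⁆ = -(f • ⁅Y, J Y⁆) := by
      rw [add_lie, smul_lie, smul_lie, lie_self, ← lie_skew (J Y) Y, smul_zero, zero_add,
        smul_neg]
    rw [h2'] at h2
    simp only [add_lie, smul_lie, lie_self, smul_zero, add_zero] at h1
    by_cases he : e = 0
    · have hf : f ≠ 0 := by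
        rintro rfl
        exact hne (by rw [hm, he]; simp)
      exact (Submodule.smul_mem_iff L hf).1 (neg_mem_iff.1 h2)
    · exact (Submodule.smul_mem_iff L he).1 h1
  have hJYY : ⁅J Y, Y⁆ = 0 := by rw [← lie_skew, hYJY, neg_zero]
  have hYU : ⁅Y, U⁆ = 0 := by rw [← lie_skew, hUY, neg_zero]
  have hJYU : ⁅J Y, U⁆ = 0 := by rw [← lie_skew, hUJY, neg_zero]
  have hTU : ⁅T, U⁆ = -Y := by rw [← lie_skew, hUT]
  have hJTU : ⁅J T, U⁆ = -J Y := by rw [← lie_skew, hUJT]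
  -- the bracket of `T` and `JT`
  have hk : ⁅U, ⁅T, J T⁆⁆ = 0 := by
    obtain ⟨a, b, c, d, e, f, hkk⟩ := hspan ⁅T, J T⁆
    let K : Submodule ℝ 𝔤 := LinearMap.ker (LieAlgebra.ad ℝ 𝔤 U : 𝔤 →ₗ[ℝ] 𝔤)
    have hK : ∀ k, k ∈ K ↔ ⁅U, k⁆ = 0 := fun k => Iff.rfl
    have hKi : ∀ k ∈ K, ∀ x : 𝔤, ⁅k, x⁆ ∈ K := by
      intro k hk x
      obtain ⟨a, b, c, d, rfl⟩ := hker k hk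
      obtain ⟨e, f, hx⟩ := him x
      rw [hK, leibniz_lie, (hK _).1 hk, hx, zero_lie, zero_add]
      simp [hX, hUY, hUJY, hYJY, hJYY]
    have hκ : a • X + b • U + c • Y + d • J Y ∈ K := by
      rw [hK]
      simp [hXr, hUY, hUJY]
    -- Modulo the ideal `K = ker (ad U)` the bracket is `e T + f J T`, and bracketing with `J T` and
    -- `T` reproduces it up to the factors `e` and `-f`.
    by_contra hne
    refine hne ((hK _).1 (subset_of_forall_lie_mem {⁅T, J T⁆} K hKi (fun L hKL hL => ?_) _ rfl))
    rintro _ rfl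
    have h1 := hL _ rfl T
    have h2 := hL _ rfl (J T)
    nth_rewrite 1 [hkk] at h1 h2
    rw [add_assoc, add_lie] at h1 h2
    have h1' := (Submodule.add_mem_iff_right L (hKL (hKi _ hκ T))).1 h1
    have h2' := (Submodule.add_mem_iff_right L (hKL (hKi _ hκ (J T)))).1 h2
    have e1 : ⁅e • T + f • J T, T⁆ = -(f • ⁅T, J T⁆) := by
      rw [add_lie, smul_lie, smul_lie, lie_self, ← lie_skew (J T) T, smul_zero, zero_add,
        smul_neg]
    have e2 : ⁅e • T + f • J T, J T⁆ = e • ⁅T, J T⁆ := by simp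
    rw [e1, neg_mem_iff] at h1'
    rw [e2] at h2'
    by_cases he : e = 0
    · have hf : f ≠ 0 := by
        rintro rfl
        apply hne
        rw [hkk, he]
        simpa using (hK _).1 hκ
      exact (Submodule.smul_mem_iff L hf).1 h1'
    · exact (Submodule.smul_mem_iff L he).1 h2'
  have hq : ⁅J Y, T⁆ = ⁅Y, J T⁆ := by
    rw [leibniz_lie, hUT, hUJT, ← lie_skew T, ← sub_eq_add_neg, sub_eq_zero] at hk
    exact hk.symm
  have hw := hJ.nijenhuis Y T
  rw [hq] at hw
  -- A nonzero `U`-coefficient `b` would make the span of `U + (a / b) X`, `Y`, `J Y` lie in the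
  -- span of its own brackets.
  have hUcoef : ∀ y, y = Y ∨ y = J Y → ∀ (x : 𝔤) (a b c d : ℝ),
      ⁅y, x⁆ = a • X + b • U + c • Y + d • J Y → b = 0 := by
    intro y hy x a b c d hyx
    by_contra hb
    refine hY0 (eq_zero_of_forall_lie_mem {U + (b⁻¹ * a) • X, Y, J Y} (fun L hL => ?_) Y
      (by simp))
    have hYL : Y ∈ L := by
      have := hL (U + (b⁻¹ * a) • X) (by simp) T
      simpa [hX, hUT] using this
    have hJYL : J Y ∈ L := by
      have := hL (U + (b⁻¹ * a) • X) (by simp) (J T)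
      simpa [hX, hUJT] using this
    have hyL : ⁅y, x⁆ ∈ L := hL y (by rcases hy with rfl | rfl <;> simp) x
    have hUL : U + (b⁻¹ * a) • X ∈ L := by
      have : U + (b⁻¹ * a) • X = b⁻¹ • (⁅y, x⁆ - c • Y - d • J Y) := by
        rw [hyx]
        have : a • X + b • U + c • Y + d • J Y - c • Y - d • J Y = a • X + b • U := by abel
        rw [this, smul_add, smul_smul, smul_smul, inv_mul_cancel₀ hb, one_smul, add_comm]
      rw [this]
      exact L.smul_mem _ (sub_mem (sub_mem hyL (L.smul_mem _ hYL)) (L.smul_mem _ hJYL))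
    intro s hs
    simp only [Set.mem_insert_iff, Set.mem_singleton_iff] at hs
    rcases hs with rfl | rfl | rfl <;> assumption
  obtain ⟨p₁, p₂, p₃, p₄, hp⟩ := hker ⁅Y, T⁆ (by rw [leibniz_lie, hUY, hUT]; simp)
  obtain ⟨q₁, q₂, q₃, q₄, hqq⟩ := hker ⁅Y, J T⁆ (by rw [leibniz_lie, hUY, hUJT, hYJY]; simp)
  obtain rfl : p₂ = 0 := hUcoef Y (.inl rfl) T _ _ _ _ hp
  obtain rfl : q₂ = 0 := hUcoef Y (.inl rfl) (J T) _ _ _ _ hqq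
  have hJq : J ⁅Y, J T⁆ = q₁ • U + q₃ • J Y - q₄ • Y := by
    rw [hqq]
    simp [hJY, ← hU, sub_eq_add_neg]
  have hw' : ⁅J Y, J T⁆ =
      p₁ • X + (2 * q₁) • U + (p₃ - 2 * q₄) • Y + (p₄ + 2 * q₃) • J Y := by
    rw [hw, hJq, hp]
    module
  -- Since `J X = U`, the Nijenhuis identity turns the `X`-coefficient `q₁` of `⁅Y, J T⁆` into the
  -- `U`-coefficient `2 q₁` of `⁅J Y, J T⁆`.
  obtain rfl : q₁ = 0 := by
    have := hUcoef (J Y) (.inr rfl) (J T) _ _ _ _ hw'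
    linarith
  have hspX : ∀ k ∈ Submodule.span ℝ {X}, ∀ x : 𝔤, ⁅k, x⁆ ∈ Submodule.span ℝ {X} := by
    intro k hk x
    obtain ⟨a, rfl⟩ := Submodule.mem_span_singleton.1 hk
    simp [hX]
  have hnX : ∀ a b : ℝ, a • Y + b • J Y ∈ Submodule.span ℝ {X} → a = 0 ∧ b = 0 := by
    intro a b hab
    obtain ⟨t, ht⟩ := Submodule.mem_span_singleton.1 hab
    have := hind (-t) 0 a b 0 0 (by rw [neg_smul, ht]; module)
    exact ⟨this.2.2.1, this.2.2.2.1⟩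
  -- Modulo `X`, `⁅Y, J T⁆` is `q₃ Y + q₄ J Y` and `⁅J Y, J T⁆ - ⁅Y, T⁆` is twice its `J`-image. If
  -- nonzero, they span the plane of `Y` and `J Y`, against nilpotency.
  obtain ⟨rfl, rfl⟩ : q₃ = 0 ∧ q₄ = 0 := by
    by_contra hne
    have hpos : q₃ * q₃ + q₄ * q₄ ≠ 0 := by
      intro h
      apply hne
      constructor <;> nlinarith [mul_self_nonneg q₃, mul_self_nonneg q₄]
    have := subset_of_forall_lie_mem {Y, J Y} (Submodule.span ℝ {X}) hspX
      (fun L hXL hL => ?_) Y (by simp)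
    · have := hnX 1 0 (by simpa using this)
      norm_num at this
    have hXL : X ∈ L := hXL (Submodule.mem_span_singleton_self X)
    have h1 := hL Y (by simp) T
    have h2 := hL Y (by simp) (J T)
    have h3 := hL (J Y) (by simp) (J T)
    have hYL : (q₃ * q₃ + q₄ * q₄) • Y ∈ L := by
      have : (q₃ * q₃ + q₄ * q₄) • Y =
          q₃ • ⁅Y, J T⁆ - (q₄ * 2⁻¹) • (⁅J Y, J T⁆ - ⁅Y, T⁆) := by
        rw [hw', hp, hqq]
        module
      rw [this]
      exact sub_mem (L.smul_mem _ h2) (L.smul_mem _ (sub_mem h3 h1))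
    have hJYL : (q₃ * q₃ + q₄ * q₄) • J Y ∈ L := by
      have : (q₃ * q₃ + q₄ * q₄) • J Y =
          q₄ • ⁅Y, J T⁆ + (q₃ * 2⁻¹) • (⁅J Y, J T⁆ - ⁅Y, T⁆) := by
        rw [hw', hp, hqq]
        module
      rw [this]
      exact add_mem (L.smul_mem _ h2) (L.smul_mem _ (sub_mem h3 h1))
    rw [Submodule.smul_mem_iff L hpos] at hYL hJYL
    intro s hs
    simp only [Set.mem_insert_iff, Set.mem_singleton_iff] at hs
    rcases hs with rfl | rfl <;> assumption
  replace hqq : ⁅Y, J T⁆ = 0 := by rw [hqq]; simp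
  rw [hqq] at hq
  replace hw' : ⁅J Y, J T⁆ = ⁅Y, T⁆ := by rw [hw', hp]; module
  -- Modulo `X`, the vector `p₃ Y + p₄ J Y` is an eigenvector of bracketing with `T` and `J T`, with
  -- eigenvalues `p₃` and `p₄`.
  obtain ⟨rfl, rfl⟩ : p₃ = 0 ∧ p₄ = 0 := by
    by_contra hne
    refine hne (hnX _ _ (subset_of_forall_lie_mem {p₃ • Y + p₄ • J Y} (Submodule.span ℝ {X}) hspX
      (fun L hXL hL => ?_) _ rfl))
    have hXL : X ∈ L := hXL (Submodule.mem_span_singleton_self X)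
    have h1 := hL _ rfl T
    have h2 := hL _ rfl (J T)
    rintro _ rfl
    have e1 : ⁅p₃ • Y + p₄ • J Y, T⁆ = p₃ • (p₃ • Y + p₄ • J Y) + (p₃ * p₁) • X := by
      rw [add_lie, smul_lie, smul_lie, hq, hp]
      module
    have e2 : ⁅p₃ • Y + p₄ • J Y, J T⁆ = p₄ • (p₃ • Y + p₄ • J Y) + (p₄ * p₁) • X := by
      rw [add_lie, smul_lie, smul_lie, hqq, hw', hp]
      module
    rw [e1, Submodule.add_mem_iff_left _ (L.smul_mem _ hXL)] at h1
    rw [e2, Submodule.add_mem_iff_left _ (L.smul_mem _ hXL)] at h2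
    by_cases h3 : p₃ = 0
    · have h4 : p₄ ≠ 0 := fun h => hne ⟨h3, h⟩
      exact (Submodule.smul_mem_iff L h4).1 h2
    · exact (Submodule.smul_mem_iff L h3).1 h1
  replace hp : ⁅Y, T⁆ = p₁ • X := by rw [hp]; simp
  rw [hp] at hw'
  -- Otherwise `Y` and `J Y` would both be central.
  have hp0 : p₁ ≠ 0 := by
    rintro rfl
    refine hY0 (h0 Y (fun v => ?_) (fun v => ?_)) <;> obtain ⟨a, b, c, d, e, f, rfl⟩ := hspan v
    · simp [hXr, hYU, hYJY, hp, hqq]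
    · simp [hXr, hJYU, hJYY, hq, hw']
  obtain ⟨k₁, k₂, k₃, k₄, hkk⟩ := hker _ hk
  have hTY : ⁅T, Y⁆ = -(p₁ • X) := by rw [← lie_skew, hp]
  have hJTJY : ⁅J T, J Y⁆ = -(p₁ • X) := by rw [← lie_skew, hw']
  have hTJY : ⁅T, J Y⁆ = 0 := by rw [← lie_skew, hq, neg_zero]
  have hJTY : ⁅J T, Y⁆ = 0 := by rw [← lie_skew, hqq, neg_zero]
  -- The corrections remove the `X`, `Y` and `J Y` components of `⁅T, J T⁆`. The `X` component is
  -- removed in two equal halves, one through `T` and one through `J T`, hence `k₁ / (2 p₁)`.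
  obtain ⟨T', hT'⟩ : ∃ T', T' = T + k₃ • X + (-k₄) • U + (-(k₁ / (2 * p₁))) • J Y := ⟨_, rfl⟩
  have hJT' : J T' = J T + k₃ • U + k₄ • X + (k₁ / (2 * p₁)) • Y := by
    rw [hT']
    simp only [map_add, map_smul, hJU, hJY, ← hU]
    module
  have hTT' : ⁅T', J T'⁆ = k₂ • U := by
    rw [hJT', hT']
    simp only [add_lie, lie_add, smul_lie, lie_smul, hX, hXr, hUY, hUJT, hJYY,
      hJYU, hTU, hw', hTY, hkk, lie_self]
    match_scalars <;> field_simp <;> ring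
  have hT'Y : ⁅T', Y⁆ = -(p₁ • X) := by simp [hT', hX, hUY, hTY, hJYY]
  have hT'JY : ⁅T', J Y⁆ = 0 := by simp [hT', hX, hUJY, hTJY]
  have hT'U : ⁅T', U⁆ = -Y := by simp [hT', hX, hTU, hJYU]
  have hJT'Y : ⁅J T', Y⁆ = 0 := by simp [hJT', hX, hUY, hJTY]
  have hJT'JY : ⁅J T', J Y⁆ = -(p₁ • X) := by simp [hJT', hX, hUJY, hJTJY, hYJY]
  have hJT'U : ⁅J T', U⁆ = -J Y := by simp [hJT', hX, hJTU, hYU]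
  have habs : 0 < |p₁| := abs_pos.2 hp0
  -- Scaling `T'` by `μ` and `Y` by `μ / 2` keeps `⁅E₁, E₃⁆ = -2 E₂` and multiplies `p₁` by `μ² /
  -- 2`, so its size becomes 2; only the sign of `p₁` survives, as `c`.
  obtain ⟨μ, hμ0, hμ⟩ : ∃ μ : ℝ, μ ≠ 0 ∧ μ * μ * |p₁| = 4 := by
    refine ⟨2 / √|p₁|, by positivity, ?_⟩
    rw [div_mul_div_comm, Real.mul_self_sqrt habs.le]
    field_simp
    norm_num
  obtain ⟨c, hc, hcp⟩ : ∃ c : ℝ, (c = 1 ∨ c = -1) ∧ μ * μ * p₁ = 4 * c := by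
    rcases abs_choice p₁ with h | h
    · exact ⟨1, .inl rfl, by rw [h] at hμ; linarith⟩
    · exact ⟨-1, .inr rfl, by rw [h] at hμ; linarith⟩
  have hsc : ∀ t : ℝ, t = μ * (μ / 2) → -(t • p₁ • X) = (2 * c) • -X := by
    rintro t rfl
    have : μ * (μ / 2) * p₁ = 2 * c := by linarith
    rw [smul_smul, this, smul_neg]
  refine ⟨μ * μ * k₂ / 2, c, μ • T', (μ / 2) • Y, U, hc, ?_⟩
  refine
    { linearIndependent := ?_, lie_one_Jone := ?_, lie_one_two := ?_, lie_Jone_Jtwo := ?_,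
      lie_one_Jtwo := ?_, lie_Jone_two := ?_, lie_two_Jtwo := ?_, lie_one_three := ?_,
      lie_Jone_three := ?_, lie_two_three := ?_, lie_Jtwo_three := ?_, lie_Jthree := ?_ }
  · rw [Fintype.linearIndependent_iff]
    intro g hg
    simp only [Fin.sum_univ_six, Matrix.cons_val, map_smul, hJU, hJT'] at hg
    simp only [hT'] at hg
    have key := hind (g 0 * μ * k₃ + g 1 * μ * k₄ - g 5)
      (-(g 0 * μ * k₄) + g 1 * μ * k₃ + g 4)
      (g 1 * μ * (k₁ / (2 * p₁)) + g 2 * (μ / 2))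
      (-(g 0 * μ * (k₁ / (2 * p₁))) + g 3 * (μ / 2)) (g 0 * μ) (g 1 * μ)
      (by rw [← hg]; module)
    obtain ⟨h5, h4, h2, h3, h0, h1⟩ := key
    have h0 : g 0 = 0 := (mul_eq_zero.1 h0).resolve_right hμ0
    have h1 : g 1 = 0 := (mul_eq_zero.1 h1).resolve_right hμ0
    simp only [h0, h1] at h2 h3 h4 h5
    have h2 : g 2 = 0 := by simpa [hμ0] using h2
    have h3 : g 3 = 0 := by simpa [hμ0] using h3
    have h4 : g 4 = 0 := by simpa using h4
    have h5 : g 5 = 0 := by simpa using h5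
    intro i
    fin_cases i
    exacts [h0, h1, h2, h3, h4, h5]
  · rw [map_smul, smul_lie, lie_smul, hTT']
    module
  · rw [smul_lie, lie_smul, hT'Y, hJU, smul_neg, smul_neg, smul_smul]
    exact hsc _ rfl
  · rw [map_smul, map_smul, smul_lie, lie_smul, hJT'JY, hJU, smul_neg, smul_neg, smul_smul]
    exact hsc _ rfl
  · simp [hT'JY]
  · simp [hJT'Y]
  · simp [hYJY]
  · rw [smul_lie, hT'U]
    module
  · rw [map_smul, map_smul, smul_lie, hJT'U]
    module
  · simp [hYU]
  · simp [hJYU]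
  · simp [hJU, hX]

end Classification
-- Duality between (1,0)-bases and real frames
section DualFrames

variable {𝔤 : Type*} [LieRing 𝔤] [LieAlgebra ℝ 𝔤] {J : 𝔤 →ₗ[ℝ] 𝔤}

theorem mem_formsOneZero {α : 𝔤 →ₗ[ℝ] ℂ} :
    α ∈ formsOneZero J ↔ ∀ X, α (J X) = -Complex.I * α X := by
  rw [formsOneZero, Module.End.mem_eigenspace_iff, LinearMap.ext_iff]
  refine forall_congr' fun X => ?_
  change -α (J X) = Complex.I * α X ↔ _
  rw [neg_eq_iff_eq_neg, neg_mul]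

/-- The (1,0)-forms separate points. -/
theorem eq_zero_of_forall_basis_eq_zero {ι : Type*} (hJ : IsComplexStructure J)
    (ω : Module.Basis ι ℂ (formsOneZero J)) {X : 𝔤}
    (hX : ∀ k, (ω k : 𝔤 →ₗ[ℝ] ℂ) X = 0) : X = 0 := by
  have hall : ∀ α : formsOneZero J, (α : 𝔤 →ₗ[ℝ] ℂ) X = 0 := by
    intro α
    let ev : formsOneZero J →ₗ[ℂ] ℂ :=
      { toFun := fun β => (β : 𝔤 →ₗ[ℝ] ℂ) X
        map_add' := fun _ _ => rfl
        map_smul' := fun _ _ => rfl }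
    have : ev = 0 := ω.ext hX
    exact LinearMap.congr_fun this α
  rw [← Module.forall_dual_apply_eq_zero_iff ℝ]
  intro f
  -- Every real form `f` is the real part of the (1,0)-form `f + i f ∘ J`.
  let α : 𝔤 →ₗ[ℝ] ℂ :=
    { toFun := fun Y => (f Y : ℂ) + Complex.I * f (J Y)
      map_add' := fun Y Z => by simp only [map_add, Complex.ofReal_add]; ring
      map_smul' := fun c Y => by
        simp only [map_smul, smul_eq_mul, Complex.ofReal_mul, RingHom.id_apply, Complex.real_smul]
        ring }
  have hα : α ∈ formsOneZero J := by
    rw [mem_formsOneZero]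
    intro Y
    change (f (J Y) : ℂ) + Complex.I * f (J (J Y)) = -Complex.I * (f Y + Complex.I * f (J Y))
    rw [hJ.sq, map_neg, Complex.ofReal_neg]
    linear_combination (f (J Y) : ℂ) * Complex.I_mul_I
  have h : (f X : ℂ) + Complex.I * f (J X) = 0 := hall ⟨α, hα⟩
  simpa using congrArg Complex.re h

theorem exists_dual_vectors (hdim : Module.finrank ℝ 𝔤 = 6) (hJ : IsComplexStructure J)
    (ω : Module.Basis (Fin 3) ℂ (formsOneZero J)) :
    ∃ E : Fin 3 → 𝔤, ∀ j k, (ω j : 𝔤 →ₗ[ℝ] ℂ) (E k) = if j = k then 1 else 0 := by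
  have : FiniteDimensional ℝ 𝔤 := Module.finite_of_finrank_pos (by omega)
  let Φ : 𝔤 →ₗ[ℝ] (Fin 3 → ℂ) := LinearMap.pi fun k => (ω k : 𝔤 →ₗ[ℝ] ℂ)
  have hinj : Function.Injective Φ := by
    rw [injective_iff_map_eq_zero]
    exact fun X hX => eq_zero_of_forall_basis_eq_zero hJ ω fun k => congrFun hX k
  have hsurj : Function.Surjective Φ :=
    (LinearMap.injective_iff_surjective_of_finrank_eq_finrank (by
      rw [hdim, Module.finrank_pi_fintype]; simp)).1 hinj
  choose E hE using fun k : Fin 3 => hsurj (Pi.single k 1)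
  refine ⟨E, fun j k => ?_⟩
  have := congrFun (hE k) j
  rwa [Pi.single_apply] at this

/-- The minus signs come from `α (J X) = -i α X` for (1,0)-forms. -/
theorem eq_sum_dual_vectors (hJ : IsComplexStructure J)
    (ω : Module.Basis (Fin 3) ℂ (formsOneZero J)) {E : Fin 3 → 𝔤}
    (hE : ∀ j k, (ω j : 𝔤 →ₗ[ℝ] ℂ) (E k) = if j = k then 1 else 0) (X : 𝔤) :
    X = ((ω 0 : 𝔤 →ₗ[ℝ] ℂ) X).re • E 0 + (-((ω 0 : 𝔤 →ₗ[ℝ] ℂ) X).im) • J (E 0) +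
      ((ω 1 : 𝔤 →ₗ[ℝ] ℂ) X).re • E 1 + (-((ω 1 : 𝔤 →ₗ[ℝ] ℂ) X).im) • J (E 1) +
      ((ω 2 : 𝔤 →ₗ[ℝ] ℂ) X).re • E 2 + (-((ω 2 : 𝔤 →ₗ[ℝ] ℂ) X).im) • J (E 2) := by
  rw [← sub_eq_zero]
  refine eq_zero_of_forall_basis_eq_zero hJ ω fun k => ?_
  have hk := mem_formsOneZero.1 (ω k).2
  simp only [map_sub, map_add, map_smul, hk, hE]
  fin_cases k <;> apply Complex.ext <;> simp

theorem linearIndependent_dual_vectors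
    (ω : Module.Basis (Fin 3) ℂ (formsOneZero J)) {E : Fin 3 → 𝔤}
    (hE : ∀ j k, (ω j : 𝔤 →ₗ[ℝ] ℂ) (E k) = if j = k then 1 else 0) :
    LinearIndependent ℝ ![E 0, J (E 0), E 1, J (E 1), E 2, J (E 2)] := by
  rw [Fintype.linearIndependent_iff]
  intro g hg
  simp only [Fin.sum_univ_six, Matrix.cons_val] at hg
  have key : ∀ k : Fin 3, (ω k : 𝔤 →ₗ[ℝ] ℂ) (g 0 • E 0 + g 1 • J (E 0) + g 2 • E 1 +
      g 3 • J (E 1) + g 4 • E 2 + g 5 • J (E 2)) = 0 := fun k => by rw [hg, map_zero]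
  simp only [map_add, map_smul, mem_formsOneZero.1 (ω _).2, hE] at key
  have k0 := key 0
  have k1 := key 1
  have k2 := key 2
  simp [Complex.ext_iff] at k0 k1 k2
  intro i
  fin_cases i
  exacts [k0.1, k0.2, k1.1, k1.2, k2.1, k2.2]

theorem exists_basis_of_frame (hdim : Module.finrank ℝ 𝔤 = 6) (hJ : IsComplexStructure J)
    (E : Fin 3 → 𝔤) (hE : LinearIndependent ℝ ![E 0, J (E 0), E 1, J (E 1), E 2, J (E 2)]) :
    ∃ ω : Module.Basis (Fin 3) ℂ (formsOneZero J),
      ∀ j k, (ω j : 𝔤 →ₗ[ℝ] ℂ) (E k) = if j = k then 1 else 0 := by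
  let B := basisOfLinearIndependentOfCardEqFinrank hE (by simp [hdim])
  have hB : ⇑B = ![E 0, J (E 0), E 1, J (E 1), E 2, J (E 2)] :=
    coe_basisOfLinearIndependentOfCardEqFinrank _ _
  let ev : formsOneZero J →ₗ[ℂ] (Fin 3 → ℂ) :=
    { toFun := fun α k => (α : 𝔤 →ₗ[ℝ] ℂ) (E k)
      map_add' := fun _ _ => rfl
      map_smul' := fun _ _ => rfl }
  have hinj : Function.Injective ev := by
    rw [injective_iff_map_eq_zero]
    intro α hα
    have h : ∀ k, (α : 𝔤 →ₗ[ℝ] ℂ) (E k) = 0 := fun k => congrFun hα k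
    have hJ := mem_formsOneZero.1 α.2
    refine Subtype.ext (B.ext fun i => ?_)
    rw [hB]
    fin_cases i <;> simp [h, hJ]
  have hsurj : Function.Surjective ev := by
    intro c
    let α : 𝔤 →ₗ[ℝ] ℂ := B.constr ℝ ![c 0, -Complex.I * c 0, c 1, -Complex.I * c 1, c 2,
      -Complex.I * c 2]
    have hα : ∀ i, α (![E 0, J (E 0), E 1, J (E 1), E 2, J (E 2)] i) =
        ![c 0, -Complex.I * c 0, c 1, -Complex.I * c 1, c 2, -Complex.I * c 2] i := by
      intro i
      rw [← hB]
      exact B.constr_basis ℝ _ i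
    have h0 : α (E 0) = c 0 := hα 0
    have h1 : α (J (E 0)) = -Complex.I * c 0 := hα 1
    have h2 : α (E 1) = c 1 := hα 2
    have h3 : α (J (E 1)) = -Complex.I * c 1 := hα 3
    have h4 : α (E 2) = c 2 := hα 4
    have h5 : α (J (E 2)) = -Complex.I * c 2 := hα 5
    have hmem : α ∈ formsOneZero J := by
      rw [mem_formsOneZero]
      intro X
      have : α ∘ₗ J = ((-Complex.I) • α : 𝔤 →ₗ[ℝ] ℂ) := by
        refine B.ext fun i => ?_
        have hI : ∀ z : ℂ, -z = Complex.I * (Complex.I * z) := fun z => by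
          rw [← mul_assoc, Complex.I_mul_I, neg_one_mul]
        rw [hB]
        fin_cases i <;> simp [h0, h1, h2, h3, h4, h5, hJ.sq, ← hI]
      exact LinearMap.congr_fun this X
    refine ⟨⟨α, hmem⟩, ?_⟩
    funext k
    fin_cases k
    exacts [h0, h2, h4]
  let e := LinearEquiv.ofBijective ev ⟨hinj, hsurj⟩
  refine ⟨Module.Basis.ofEquivFun e, fun j k => ?_⟩
  have : e (Module.Basis.ofEquivFun e j) = Pi.single j 1 := by simp
  refine (congrFun this k).trans ?_
  rw [Pi.single_apply]
  simp only [eq_comm]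

theorem ReducedFrame.lie_eq {ε c : ℝ} {E₁ E₂ E₃ : 𝔤} (h : ReducedFrame J ε c E₁ E₂ E₃)
    (a₁ b₁ a₂ b₂ a₃ b₃ x₁ y₁ x₂ y₂ x₃ y₃ : ℝ) :
    ⁅a₁ • E₁ + b₁ • J E₁ + a₂ • E₂ + b₂ • J E₂ + a₃ • E₃ + b₃ • J E₃,
      x₁ • E₁ + y₁ • J E₁ + x₂ • E₂ + y₂ • J E₂ + x₃ • E₃ + y₃ • J E₃⁆ =
    (-2 * (a₁ * x₃ - a₃ * x₁)) • E₂ + (-2 * (b₁ * x₃ - a₃ * y₁)) • J E₂ +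
      (2 * ε * (a₁ * y₁ - b₁ * x₁)) • E₃ +
      (2 * c * (a₁ * x₂ - a₂ * x₁ + b₁ * y₂ - b₂ * y₁)) • J E₃ := by
  have hr : ∀ Z : 𝔤, ⁅Z, J E₃⁆ = 0 := fun Z => by rw [← lie_skew, h.lie_Jthree, neg_zero]
  have h1 : ⁅J E₁, E₁⁆ = -((2 * ε) • E₃) := by rw [← lie_skew, h.lie_one_Jone]
  have h2 : ⁅E₂, E₁⁆ = -((2 * c) • J E₃) := by rw [← lie_skew, h.lie_one_two]
  have h3 : ⁅J E₂, J E₁⁆ = -((2 * c) • J E₃) := by rw [← lie_skew, h.lie_Jone_Jtwo]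
  have h4 : ⁅J E₂, E₁⁆ = 0 := by rw [← lie_skew, h.lie_one_Jtwo, neg_zero]
  have h5 : ⁅E₂, J E₁⁆ = 0 := by rw [← lie_skew, h.lie_Jone_two, neg_zero]
  have h6 : ⁅J E₂, E₂⁆ = 0 := by rw [← lie_skew, h.lie_two_Jtwo, neg_zero]
  have h7 : ⁅E₃, E₁⁆ = -((-2 : ℝ) • E₂) := by rw [← lie_skew, h.lie_one_three]
  have h8 : ⁅E₃, J E₁⁆ = -((-2 : ℝ) • J E₂) := by rw [← lie_skew, h.lie_Jone_three]
  have h9 : ⁅E₃, E₂⁆ = 0 := by rw [← lie_skew, h.lie_two_three, neg_zero]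
  have h10 : ⁅E₃, J E₂⁆ = 0 := by rw [← lie_skew, h.lie_Jtwo_three, neg_zero]
  simp only [add_lie, lie_add, smul_lie, lie_smul, lie_self, h.lie_one_Jone, h.lie_one_two,
    h.lie_Jone_Jtwo, h.lie_one_Jtwo, h.lie_Jone_two, h.lie_two_Jtwo, h.lie_one_three,
    h.lie_Jone_three, h.lie_two_three, h.lie_Jtwo_three, h.lie_Jthree, hr, h1, h2, h3, h4, h5, h6,
    h7, h8, h9, h10]
  module

theorem reducedEquations_iff {ε c : ℝ} {ω₁ ω₂ ω₃ : 𝔤 →ₗ[ℝ] ℂ} :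
    ReducedEquations ε c ω₁ ω₂ ω₃ ↔ ∀ X Y : 𝔤,
      ω₁ ⁅X, Y⁆ = 0 ∧
      ω₂ ⁅X, Y⁆ = -(ω₁ X * (ω₃ Y + conj (ω₃ Y)) - ω₁ Y * (ω₃ X + conj (ω₃ X))) ∧
      ω₃ ⁅X, Y⁆ = -(Complex.I * ε * (ω₁ X * conj (ω₁ Y) - ω₁ Y * conj (ω₁ X)) +
        c * Complex.I * (ω₁ X * conj (ω₂ Y) - ω₁ Y * conj (ω₂ X) -
          (ω₂ X * conj (ω₁ Y) - ω₂ Y * conj (ω₁ X)))) := by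
  have hv : ∀ v : Fin 2 → 𝔤, v = ![v 0, v 1] := fun v => by
    funext i; fin_cases i <;> rfl
  have hconj : ∀ (α : 𝔤 →ₗ[ℝ] ℂ) X, conjForm α X = conj (α X) := fun _ _ => rfl
  constructor
  · rintro ⟨h1, h2, h3⟩ X Y
    replace h1 := congrFun h1 ![X, Y]
    replace h2 := congrFun h2 ![X, Y]
    replace h3 := congrFun h3 ![X, Y]
    simp only [ceDiff_oneForm_apply, AlternatingMap.add_apply, AlternatingMap.sub_apply,
      AlternatingMap.smul_apply, wedgeOne_apply, hconj, smul_eq_mul, Pi.zero_apply] at h1 h2 h3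
    refine ⟨?_, ?_, ?_⟩
    · linear_combination -h1
    · linear_combination -h2
    · linear_combination -h3
  · intro h
    refine ⟨?_, ?_, ?_⟩ <;> funext v <;> rw [hv v] <;>
      obtain ⟨h1, h2, h3⟩ := h (v 0) (v 1) <;>
      simp only [ceDiff_oneForm_apply, AlternatingMap.add_apply, AlternatingMap.sub_apply,
        AlternatingMap.smul_apply, wedgeOne_apply, hconj, smul_eq_mul, Pi.zero_apply]
    · linear_combination -h1
    · linear_combination -h2
    · linear_combination -h3

theorem ReducedFrame.reducedEquations (hJ : IsComplexStructure J) {ε c : ℝ}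
    {E : Fin 3 → 𝔤} (h : ReducedFrame J ε c (E 0) (E 1) (E 2))
    (ω : Module.Basis (Fin 3) ℂ (formsOneZero J))
    (hE : ∀ j k, (ω j : 𝔤 →ₗ[ℝ] ℂ) (E k) = if j = k then 1 else 0) :
    ReducedEquations ε c (ω 0 : 𝔤 →ₗ[ℝ] ℂ) (ω 1 : 𝔤 →ₗ[ℝ] ℂ) (ω 2 : 𝔤 →ₗ[ℝ] ℂ) := by
  rw [reducedEquations_iff]
  intro X Y
  have hXY : ⁅X, Y⁆ = _ := (congrArg₂ _ (eq_sum_dual_vectors hJ ω hE X)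
    (eq_sum_dual_vectors hJ ω hE Y)).trans (h.lie_eq _ _ _ _ _ _ _ _ _ _ _ _)
  rw [hXY]
  simp only [map_add, map_smul, mem_formsOneZero.1 (ω _).2, hE]
  refine ⟨?_, ?_, ?_⟩
  · simp
  · apply Complex.ext <;> simp <;> ring
  · apply Complex.ext <;> simp <;> ring

theorem ReducedEquations.reducedFrame (hJ : IsComplexStructure J) {ε c : ℝ}
    {E : Fin 3 → 𝔤} (ω : Module.Basis (Fin 3) ℂ (formsOneZero J))
    (hE : ∀ j k, (ω j : 𝔤 →ₗ[ℝ] ℂ) (E k) = if j = k then 1 else 0)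
    (h : ReducedEquations ε c (ω 0 : 𝔤 →ₗ[ℝ] ℂ) (ω 1 : 𝔤 →ₗ[ℝ] ℂ) (ω 2 : 𝔤 →ₗ[ℝ] ℂ)) :
    ReducedFrame J ε c (E 0) (E 1) (E 2) := by
  rw [reducedEquations_iff] at h
  have hJω : ∀ k X, (ω k : 𝔤 →ₗ[ℝ] ℂ) (J X) = -Complex.I * (ω k : 𝔤 →ₗ[ℝ] ℂ) X :=
    fun k => mem_formsOneZero.1 (ω k).2
  have key : ∀ X Y Z : 𝔤, (ω 0 : 𝔤 →ₗ[ℝ] ℂ) Z = 0 →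
      (ω 1 : 𝔤 →ₗ[ℝ] ℂ) ⁅X, Y⁆ = (ω 1 : 𝔤 →ₗ[ℝ] ℂ) Z →
      (ω 2 : 𝔤 →ₗ[ℝ] ℂ) ⁅X, Y⁆ = (ω 2 : 𝔤 →ₗ[ℝ] ℂ) Z → ⁅X, Y⁆ = Z := by
    intro X Y Z h0 h1 h2
    rw [← sub_eq_zero]
    refine eq_zero_of_forall_basis_eq_zero hJ ω fun k => ?_
    rw [map_sub, sub_eq_zero]
    fin_cases k
    exacts [((h X Y).1).trans h0.symm, h1, h2]
  refine
    { linearIndependent := linearIndependent_dual_vectors ω hE, lie_one_Jone := ?_,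
      lie_one_two := ?_, lie_Jone_Jtwo := ?_,
      lie_one_Jtwo := ?_, lie_Jone_two := ?_, lie_two_Jtwo := ?_, lie_one_three := ?_,
      lie_Jone_three := ?_, lie_two_three := ?_, lie_Jtwo_three := ?_,
      lie_Jthree := fun Z => ?_ } <;>
    refine key _ _ _ ?_ (((h _ _).2.1).trans ?_) (((h _ _).2.2).trans ?_) <;>
    simp only [map_zero, map_smul, hJω, hE] <;> apply Complex.ext <;> simp <;> ring

end DualFrames
-- The balanced condition in a reduced frame
section Balanced

variable {𝔤 : Type*} [LieRing 𝔤] [LieAlgebra ℝ 𝔤]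

theorem HermitianStructure.fundamentalForm_apply (H : HermitianStructure 𝔤) (X Y : 𝔤) :
    H.fundamentalForm ![X, Y] = H.g X (H.J Y) := rfl

theorem HermitianStructure.g_map_left (H : HermitianStructure 𝔤) (X Y : 𝔤) :
    H.g (H.J X) Y = -H.g X (H.J Y) := by
  have h := H.compatible X (H.J Y)
  rw [H.isComplexStructure.sq, map_neg] at h
  linarith

theorem HermitianStructure.g_map_swap (H : HermitianStructure 𝔤) (X Y : 𝔤) :
    H.g X (H.J Y) = -H.g Y (H.J X) := by
  rw [← H.g_map_left, H.symm]

theorem HermitianStructure.g_map_self (H : HermitianStructure 𝔤) (X : 𝔤) :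
    H.g X (H.J X) = 0 := by
  have := H.g_map_swap X X
  linarith

/-- The last three equations say that `E₁ - (g(E₁, E₂) / g(E₂, E₂)) E₂` is orthogonal to `E₂`, `J
E₂`, `E₃` and `J E₃`. -/
theorem HermitianStructure.IsBalanced.conditions {H : HermitianStructure 𝔤} (hF : H.IsBalanced)
    {ε c : ℝ} (hc : c ≠ 0) {E₁ E₂ E₃ : 𝔤} (h : ReducedFrame H.J ε c E₁ E₂ E₃) :
    ε = 0 ∧ H.g E₁ (H.J E₂) = 0 ∧
      H.g E₁ E₃ * H.g E₂ E₂ = H.g E₁ E₂ * H.g E₂ E₃ ∧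
      H.g E₁ (H.J E₃) * H.g E₂ E₂ = H.g E₁ E₂ * H.g E₂ (H.J E₃) := by
  have hz : ∀ v, ceDiff (k := 3) (wedge (p := 2) (q := 2) H.fundamentalForm H.fundamentalForm) v
      = 0 := fun v => congrFun hF v
  -- In each tuple most brackets repeat a vector already present and drop out. The first leaves `ε`
  -- times a Gram determinant, the second isolates `c`, and the last two come from the brackets of
  -- `E₁` and `J E₁` with `E₃`.
  have e1 := hz ![E₁, H.J E₁, E₂, H.J E₂, H.J E₃]
  have e2 := hz ![E₁, H.J E₁, E₂, H.J E₂, E₃]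
  have e3 := hz ![E₁, H.J E₁, H.J E₂, E₃, H.J E₃]
  have e4 := hz ![E₁, H.J E₁, E₂, E₃, H.J E₃]
  have hr : ∀ Z : 𝔤, ⁅Z, H.J E₃⁆ = 0 := fun Z => by rw [← lie_skew, h.lie_Jthree, neg_zero]
  simp only [ceDiff_three_apply, wedge_two_two_apply, H.fundamentalForm_apply, h.lie_one_Jone,
    h.lie_one_two, h.lie_Jone_Jtwo, h.lie_one_Jtwo, h.lie_Jone_two, h.lie_two_Jtwo,
    h.lie_one_three, h.lie_Jone_three, h.lie_two_three, h.lie_Jtwo_three, hr,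
    map_smul, map_neg, map_zero, LinearMap.smul_apply, LinearMap.zero_apply,
    smul_eq_mul, H.g_map_left, H.isComplexStructure.sq, H.g_map_self, H.symm E₂ E₁, H.symm E₃ E₁,
    H.symm E₃ E₂, H.g_map_swap E₃ E₁, H.g_map_swap E₃ E₂] at e1 e2 e3 e4
  have hli := Fintype.linearIndependent_iff.1 h.linearIndependent
  have hE₂ : 0 < H.g E₂ E₂ := H.posDef _ (h.linearIndependent.ne_zero 2)
  have hΔ : 0 < H.g E₂ E₂ * H.g E₃ E₃ - H.g E₂ E₃ ^ 2 - H.g E₂ (H.J E₃) ^ 2 := by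
    -- This vector is `g(E₂, E₂)` times the component of `E₃` orthogonal to `E₂` and `J E₂`; its
    -- squared norm is `g(E₂, E₂)` times the determinant.
    have hV := H.posDef (H.g E₂ E₂ • E₃ - H.g E₂ E₃ • E₂ + H.g E₂ (H.J E₃) • H.J E₂) (by
      intro h0
      have := hli ![0, 0, -H.g E₂ E₃, H.g E₂ (H.J E₃), H.g E₂ E₂, 0] (by
        simp only [Fin.sum_univ_six, Matrix.cons_val]
        rw [← h0]
        module) 4
      exact hE₂.ne' this)
    simp only [map_add, map_sub, map_smul, LinearMap.add_apply, LinearMap.sub_apply,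
      LinearMap.smul_apply, smul_eq_mul, H.g_map_left, H.isComplexStructure.sq, map_neg,
      H.g_map_self, H.symm E₃ E₂, H.g_map_swap E₃ E₂] at hV
    refine (pos_iff_pos_of_mul_pos (a := H.g E₂ E₂) ?_).1 hE₂
    linarith
  have e2' : H.g E₃ E₃ * H.g E₁ (H.J E₂) + H.g E₂ (H.J E₃) * H.g E₁ E₃ -
      H.g E₂ E₃ * H.g E₁ (H.J E₃) = 0 := by
    apply mul_left_cancel₀ hc
    linarith
  have hK : H.g E₁ (H.J E₂) = 0 := by
    refine (mul_eq_zero.1 ?_).resolve_right hΔ.ne'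
    linear_combination H.g E₂ E₂ * e2' + H.g E₂ E₃ / 4 * e3 + H.g E₂ (H.J E₃) / 4 * e4
  rw [hK] at e3 e4
  refine ⟨(mul_eq_zero.1 ?_).resolve_right hΔ.ne', hK, by linarith, by linarith⟩
  linarith

/-- Both `ω k` and its conjugate take the value 1 on `E k`, so for instance `2F(E 0, E 1)` is the
coefficient `u` plus its conjugate. -/
theorem HermitianStructure.two_smul_fundamentalForm (H : HermitianStructure 𝔤)
    (ω : Module.Basis (Fin 3) ℂ (formsOneZero H.J)) {E : Fin 3 → 𝔤}
    (hE : ∀ j k, (ω j : 𝔤 →ₗ[ℝ] ℂ) (E k) = if j = k then 1 else 0) :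
    (2 : ℂ) • complexify H.fundamentalForm =
      coefficientForm (ω 0 : 𝔤 →ₗ[ℝ] ℂ) (ω 1 : 𝔤 →ₗ[ℝ] ℂ) (ω 2 : 𝔤 →ₗ[ℝ] ℂ)
        √(H.g (E 0) (E 0)) √(H.g (E 1) (E 1)) √(H.g (E 2) (E 2))
        (H.g (E 0) (H.J (E 1)) + H.g (E 0) (E 1) * Complex.I)
        (H.g (E 1) (H.J (E 2)) + H.g (E 1) (E 2) * Complex.I)
        (H.g (E 0) (H.J (E 2)) + H.g (E 0) (E 2) * Complex.I) := by
  have hnn : ∀ X, 0 ≤ H.g X X := fun X => by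
    by_cases hX : X = 0
    · simp [hX]
    · exact (H.posDef X hX).le
  have hsq : ∀ X, ((√(H.g X X) : ℝ) : ℂ) ^ 2 = H.g X X := fun X => by
    rw [← Complex.ofReal_pow, Real.sq_sqrt (hnn X)]
  have hconj : ∀ (α : 𝔤 →ₗ[ℝ] ℂ) X, conjForm α X = conj (α X) := fun _ _ => rfl
  ext v
  have hv : v = ![v 0, v 1] := by
    funext i; fin_cases i <;> rfl
  rw [hv]
  generalize v 0 = X
  generalize v 1 = Y
  have hF : ((2 : ℂ) • complexify H.fundamentalForm) ![X, Y] = 2 * (H.g X (H.J Y) : ℝ) := rfl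
  rw [hF]
  simp only [coefficientForm, AlternatingMap.add_apply, AlternatingMap.sub_apply,
    AlternatingMap.smul_apply, wedgeOne_apply, hconj, smul_eq_mul, hsq]
  have hX := eq_sum_dual_vectors H.isComplexStructure ω hE X
  have hY := eq_sum_dual_vectors H.isComplexStructure ω hE Y
  generalize (ω 0 : 𝔤 →ₗ[ℝ] ℂ) X = x₀ at *
  generalize (ω 1 : 𝔤 →ₗ[ℝ] ℂ) X = x₁ at *
  generalize (ω 2 : 𝔤 →ₗ[ℝ] ℂ) X = x₂ at *
  generalize (ω 0 : 𝔤 →ₗ[ℝ] ℂ) Y = y₀ at *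
  generalize (ω 1 : 𝔤 →ₗ[ℝ] ℂ) Y = y₁ at *
  generalize (ω 2 : 𝔤 →ₗ[ℝ] ℂ) Y = y₂ at *
  rw [hX, hY]
  simp only [map_add, map_smul, LinearMap.add_apply, LinearMap.smul_apply, smul_eq_mul,
    H.g_map_left, H.isComplexStructure.sq, map_neg, H.g_map_self, H.symm (E 1) (E 0),
    H.symm (E 2) (E 0), H.symm (E 2) (E 1), H.g_map_swap (E 1) (E 0), H.g_map_swap (E 2) (E 0),
    H.g_map_swap (E 2) (E 1)]
  apply Complex.ext <;> simp <;> ring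

theorem HermitianStructure.IsBalanced.normal_form {H : HermitianStructure 𝔤}
    (hdim : Module.finrank ℝ 𝔤 = 6) (hF : H.IsBalanced)
    (ω : Module.Basis (Fin 3) ℂ (formsOneZero H.J)) {ε c : ℝ} (hc : c ≠ 0)
    (h : ReducedEquations ε c (ω 0 : 𝔤 →ₗ[ℝ] ℂ) (ω 1 : 𝔤 →ₗ[ℝ] ℂ) (ω 2 : 𝔤 →ₗ[ℝ] ℂ)) :
    ε = 0 ∧
      ∃ (r s t : ℝ) (u v z : ℂ), r ≠ 0 ∧ s ≠ 0 ∧ t ≠ 0 ∧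
        (2 : ℂ) • complexify H.fundamentalForm =
          coefficientForm (ω 0 : 𝔤 →ₗ[ℝ] ℂ) (ω 1 : 𝔤 →ₗ[ℝ] ℂ) (ω 2 : 𝔤 →ₗ[ℝ] ℂ) r s t u v z ∧
        u + conj u = 0 ∧ z = -Complex.I * u * v / (s : ℂ) ^ 2 := by
  obtain ⟨E, hE⟩ := exists_dual_vectors hdim H.isComplexStructure ω
  have hfr := h.reducedFrame H.isComplexStructure ω hE
  obtain ⟨hε, h1, h2, h3⟩ := hF.conditions hc hfr
  have hpos : ∀ k, 0 < H.g (E k) (E k) := fun k => H.posDef _ fun h0 => by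
    have := hE k k
    simp [h0] at this
  have hs : ∀ k, √(H.g (E k) (E k)) ≠ 0 := fun k => (Real.sqrt_pos.2 (hpos k)).ne'
  refine ⟨hε, _, _, _, _, _, _, hs 0, hs 1, hs 2, H.two_smul_fundamentalForm ω hE, ?_, ?_⟩
  · simp [h1]
  · rw [← Complex.ofReal_pow, Real.sq_sqrt (hpos 1).le,
      eq_div_iff (Complex.ofReal_ne_zero.2 (hpos 1).ne'), h1]
    apply Complex.ext
    · simp
      linarith
    · simp
      linarith

end Balanced

/-! ### Identification with the model algebra -/

section Isomorphism

variable {𝔤 : Type*} [LieRing 𝔤] [LieAlgebra ℝ 𝔤]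

theorem finrank_lieN : Module.finrank ℝ LieN = 6 :=
  Module.finrank_fin_fun ℝ

theorem nonempty_lieEquiv_lieN {J : 𝔤 →ₗ[ℝ] 𝔤} (hdim : Module.finrank ℝ 𝔤 = 6)
    (hJ : IsComplexStructure J) (ω : Module.Basis (Fin 3) ℂ (formsOneZero J)) {c : ℝ} (hc : c ≠ 0)
    (h : ReducedEquations 0 c (ω 0 : 𝔤 →ₗ[ℝ] ℂ) (ω 1 : 𝔤 →ₗ[ℝ] ℂ) (ω 2 : 𝔤 →ₗ[ℝ] ℂ)) :
    Nonempty (𝔤 ≃ₗ⁅ℝ⁆ LieN) := by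
  rw [reducedEquations_iff] at h
  have : FiniteDimensional ℝ 𝔤 := Module.finite_of_finrank_pos (by omega)
  have : FiniteDimensional ℝ LieN := inferInstanceAs (FiniteDimensional ℝ (Fin 6 → ℝ))
  -- For `ε = 0` the form `Re ω³` is closed, `dω² = 2 ω¹ ∧ Re ω³`, and `dω³ = 2ci (Re ω¹ ∧ Re ω² +
  -- Im ω¹ ∧ Im ω²)`; this dictates the order, the sign and the factors `1/2` and `1/(4c)`.
  let e : 𝔤 → Fin 6 → ℝ := fun X =>
    ![((ω 0 : 𝔤 →ₗ[ℝ] ℂ) X).re, ((ω 2 : 𝔤 →ₗ[ℝ] ℂ) X).re, ((ω 0 : 𝔤 →ₗ[ℝ] ℂ) X).im,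
      ((ω 1 : 𝔤 →ₗ[ℝ] ℂ) X).re / 2, -(((ω 1 : 𝔤 →ₗ[ℝ] ℂ) X).im / 2),
      ((ω 2 : 𝔤 →ₗ[ℝ] ℂ) X).im / (4 * c)]
  have he_add : ∀ X Y, e (X + Y) = e X + e Y := by
    intro X Y
    funext i
    fin_cases i <;> simp [e] <;> ring
  have he_smul : ∀ (a : ℝ) X, e (a • X) = a • e X := by
    intro a X
    funext i
    fin_cases i <;> simp [e] <;> ring
  have he_lie : ∀ X Y, e ⁅X, Y⁆ = LieN.bracket (e X) (e Y) := by
    intro X Y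
    obtain ⟨h1, h2, h3⟩ := h X Y
    funext i
    fin_cases i
    · simp [e, LieN.bracket, h1]
    · simp [e, LieN.bracket, h3]
      exact .inr (by ring)
    · simp [e, LieN.bracket, h1]
    all_goals
      simp [e, LieN.bracket, h2, h3]
      field_simp
      ring
  have he_inj : ∀ X, e X = 0 → X = 0 := by
    intro X hX
    have h' : ∀ i, e X i = 0 := fun i => congrFun hX i
    have h0 := h' 0
    have h1 := h' 1
    have h2 := h' 2
    have h3 := h' 3
    have h4 := h' 4
    have h5 := h' 5
    simp [e, hc] at h0 h1 h2 h3 h4 h5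
    refine eq_zero_of_forall_basis_eq_zero hJ ω fun k => ?_
    fin_cases k
    exacts [Complex.ext h0 h2, Complex.ext h3 h4, Complex.ext h1 h5]
  let f : 𝔤 →ₗ⁅ℝ⁆ LieN :=
    { toFun := e
      map_add' := he_add
      map_smul' := he_smul
      map_lie' := fun {X Y} => he_lie X Y }
  have hinj : Function.Injective f := (injective_iff_map_eq_zero f).2 he_inj
  have hsurj : Function.Surjective f :=
    (LinearMap.injective_iff_surjective_of_finrank_eq_finrank (f := (f : 𝔤 →ₗ[ℝ] LieN))
      (hdim.trans finrank_lieN.symm)).1 hinj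
  exact ⟨LieEquiv.ofBijective f ⟨hinj, hsurj⟩⟩

end Isomorphism

end NilpotentBalanced

theorem proposition2p5 {𝔤 : Type*} [LieRing 𝔤] [LieAlgebra ℝ 𝔤] [LieRing.IsNilpotent 𝔤]
    (hdim : Module.finrank ℝ 𝔤 = 6)
    (H : NilpotentBalanced.HermitianStructure 𝔤)
    (hJ : ¬ NilpotentBalanced.IsNilpotentStructure H.J)
    (hF : H.IsBalanced) :
    Nonempty (𝔤 ≃ₗ⁅ℝ⁆ NilpotentBalanced.LieN) ∧
    (∃ (ω : Module.Basis (Fin 3) ℂ (NilpotentBalanced.formsOneZero H.J)) (c : ℝ),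
      (c = 1 ∨ c = -1) ∧
      NilpotentBalanced.ReducedEquations 0 c (ω 0 : 𝔤 →ₗ[ℝ] ℂ) (ω 1 : 𝔤 →ₗ[ℝ] ℂ)
        (ω 2 : 𝔤 →ₗ[ℝ] ℂ) ∧
      ∃ (r s t : ℝ) (u v z : ℂ), r ≠ 0 ∧ s ≠ 0 ∧ t ≠ 0 ∧
        (2 : ℂ) • NilpotentBalanced.complexify H.fundamentalForm =
          NilpotentBalanced.coefficientForm (ω 0 : 𝔤 →ₗ[ℝ] ℂ) (ω 1 : 𝔤 →ₗ[ℝ] ℂ)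
            (ω 2 : 𝔤 →ₗ[ℝ] ℂ) r s t u v z ∧
        u + (starRingEnd ℂ) u = 0 ∧ z = -Complex.I * u * v / (s : ℂ) ^ 2) ∧
    (∀ (ω : Module.Basis (Fin 3) ℂ (NilpotentBalanced.formsOneZero H.J)) (ε c : ℝ),
      (ε = 0 ∨ ε = 1) → (c = 1 ∨ c = -1) →
      NilpotentBalanced.ReducedEquations ε c (ω 0 : 𝔤 →ₗ[ℝ] ℂ) (ω 1 : 𝔤 →ₗ[ℝ] ℂ)
        (ω 2 : 𝔤 →ₗ[ℝ] ℂ) →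
      ε = 0 ∧
      ∃ (r s t : ℝ) (u v z : ℂ), r ≠ 0 ∧ s ≠ 0 ∧ t ≠ 0 ∧
        (2 : ℂ) • NilpotentBalanced.complexify H.fundamentalForm =
          NilpotentBalanced.coefficientForm (ω 0 : 𝔤 →ₗ[ℝ] ℂ) (ω 1 : 𝔤 →ₗ[ℝ] ℂ)
            (ω 2 : 𝔤 →ₗ[ℝ] ℂ) r s t u v z ∧
        u + (starRingEnd ℂ) u = 0 ∧ z = -Complex.I * u * v / (s : ℂ) ^ 2) := by
  have hcne : ∀ c : ℝ, c = 1 ∨ c = -1 → c ≠ 0 := by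
    rintro c (rfl | rfl) <;> norm_num
  have hJc := H.isComplexStructure
  obtain ⟨ε, c, E₁, E₂, E₃, hc, hfr⟩ :=
    NilpotentBalanced.exists_reducedFrame hdim hJc hJ
  obtain ⟨ω, hω⟩ := NilpotentBalanced.exists_basis_of_frame hdim hJc ![E₁, E₂, E₃]
    hfr.linearIndependent
  have heq := NilpotentBalanced.ReducedFrame.reducedEquations (E := ![E₁, E₂, E₃]) hJc hfr ω hω
  -- The frame carries an arbitrary real `ε`; normalizing it to 0 or 1 is unnecessary because
  -- balancedness makes it vanish.
  obtain ⟨rfl, hform⟩ := hF.normal_form hdim ω (hcne c hc) heq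
  exact ⟨NilpotentBalanced.nonempty_lieEquiv_lieN hdim hJc ω (hcne c hc) heq,
    ⟨ω, c, hc, heq, hform⟩,
    fun ω' ε' c' _ hc' h' => hF.normal_form hdim ω' (hcne c' hc') h'⟩
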